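/- All vector spaces and algebras are over $\mathbb{C}$. **The Hopf algebras $A(G,V,u,B)$.** Let $G$ be a finite group, $V$ a finite-dimensional representation of $G$, $u\in G$ a central element with $u^2=1$ acting by $-1$ on $V$, and $B\in S^2V\subset V\otimes V$ a symmetric tensor. As an algebra $A(G,V,u,B)$ is $\mathbb{C}[G]\ltimes\Lambda V$. Let $\Delta_0$ be the algebra map with $\Delta_0(g)=g\otimes g$ for $g\in G$ and $\Delta_0(v)=v\otimes 1+u\otimes v$ for $v\in V$, and put $J=\exp\big(\sum_i v_iu\otimes w_i\big)$ for $B=\sum_i v_i\otimes w_i$. The comultiplication of $A(G,V,u,B)$ is $\Delta(a)=J^{-1}\Delta_0(a)J$, and its counit and antipode are given by $\varepsilon(g)=1$, $\varepsilon(v)=0$, $S(g)=g^{-1}$, $S(v)=-uv$. **Graña's families.** Let $\Gamma$ be a finite abelian group, $g_1,g_2\in\Gamma$, and $\chi:\Gamma\to\mathbb{C}^*$ a character with $\chi(g_1)=\chi(g_2)=-1$. For $\lambda_1,\lambda_2,\lambda_3\in\mathbb{C}$ let $H$ be the Hopf algebra generated by the group $\Gamma$ and two elements $x_1,x_2$ with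 relations $$\gamma x_i=\chi(\gamma)x_i\gamma,\quad x_1^2=\lambda_1(1-g_1^2),\quad x_2^2=\lambda_2(1-g_2^2),\quad x_1x_2+x_2x_1=\lambda_3(1-g_1g_2),$$ with $\gamma\in\Gamma$ group-like and $\Delta(x_i)=x_i\otimes 1+g_i\otimes x_i$. The three families, with parameters $(\lambda_1,\lambda_2,\lambda_3)\in\mathbb{C}^3$, are: 1. $\Gamma=\mathbb{Z}_8=\langle g\rangle$, $g_1=g$, $g_2=g^3$, $\chi(g)=-1$; 2. $\Gamma=\mathbb{Z}_8=\langle g\rangle$, $g_1=g$, $g_2=g^5$, $\chi(g)=-1$; 3. $\Gamma=\mathbb{Z}_4\times\mathbb{Z}_2=\langle g\rangle\times\langle h\rangle$, $g_1=g$, $g_2=gh$, $\chi(g)=-1$, $\chi(h)=1$. **Theorem 4.1.** For all $\lambda_1,\lambda_2,\lambda_3\in\mathbb{C}$, each of these three Hopf algebras $H$ is a $32$-dimensional pointed Hopf algebra whose group of group-like elements is isomorphic to $\mathbb{Z}_8$ in cases 1 and 2 and to $\mathbb{Z}_4\times\mathbb{Z}_2$ in case 3, and there is an isomorphism of Hopf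 algebras $$H\cong A(G,V,u,B)^*,\qquad B=\begin{pmatrix}\lambda_1&\lambda_3/2\\ \lambda_3/2&\lambda_2\end{pmatrix},$$ where $B$ is written in the basis $e_1,e_2$ of $V$ given by the two listed summands, and 1. $G=\mathbb{Z}_8=\langle a\rangle$, $V=\chi_8\oplus\chi_8^3$ with $\chi_8(a^m)=e^{2\pi i m/8}$, $u=a^4$; 2. $G=\mathbb{Z}_8=\langle a\rangle$, $V=\chi_8\oplus\chi_8^5$, $u=a^4$; 3. $G=\mathbb{Z}_4\times\mathbb{Z}_2=\langle a\rangle\times\langle b\rangle$, $V=(\chi_4,\chi_+)\oplus(\chi_4,\chi_-)$ with $\chi_4(a^m)=e^{2\pi i m/4}$, $\chi_+$ the trivial and $\chi_-$ the nontrivial character of $\mathbb{Z}_2$, $u=a^2$. -/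

import Mathlib

open scoped TensorProduct
noncomputable section
namespace EtingofGelaki

section HopfDual
variable (R A : Type*) [CommRing R] [Ring A] [HopfAlgebra R A]

/-- The dual space of a Hopf algebra, as an algebra under convolution,
`(f * g) a = ∑ f a₍₁₎ * g a₍₂₎`, with the counit as its unit. -/
def HopfDual : Type _ := WithConv (A →ₗ[R] R)

namespace HopfDual

instance : Ring (HopfDual R A) := inferInstanceAs (Ring (WithConv (A →ₗ[R] R)))
instance : Algebra R (HopfDual R A) := inferInstanceAs (Algebra R (WithConv (A →ₗ[R] R)))

/-- The elements of the dual Hopf algebra are the linear forms. -/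
def toDual : HopfDual R A ≃ₗ[R] Module.Dual R A where
  toFun f := WithConv.ofConv f
  invFun f := WithConv.toConv f
  map_add' _ _ := rfl
  map_smul' _ _ := rfl
  left_inv _ := rfl
  right_inv _ := rfl

section
variable {R A}

lemma toDual_mul (f g : HopfDual R A) (a : A) {ι : Type*} (ra : Coalgebra.Repr R a ι) :
    toDual R A (f * g) a = ∑ i ∈ ra.index, toDual R A f (ra.left i) * toDual R A g (ra.right i) :=
  ra.convMul_apply (WithConv.toConv (toDual R A f)) (WithConv.toConv (toDual R A g))

lemma toDual_one (a : A) : toDual R A 1 a = Coalgebra.counit (R := R) a := rfl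

lemma toDual_algebraMap (r : R) (a : A) :
    toDual R A (algebraMap R _ r) a = r * Coalgebra.counit (R := R) a := rfl

end

section
variable [Module.Free R A] [Module.Finite R A]

/-- The identification `A* ⊗ A* ≃ (A ⊗ A)*`, `(f ⊗ g) (a ⊗ b) = f a * g b`. -/
def pairing : HopfDual R A ⊗[R] HopfDual R A ≃ₗ[R] Module.Dual R (A ⊗[R] A) :=
  (TensorProduct.congr (toDual R A) (toDual R A)).trans (TensorProduct.dualDistribEquiv R A A)

/-- The comultiplication of the dual is the transpose of the multiplication. -/
def comulMap : HopfDual R A →ₗ[R] HopfDual R A ⊗[R] HopfDual R A :=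
  (pairing R A).symm.toLinearMap ∘ₗ (LinearMap.mul' R A).dualMap ∘ₗ (toDual R A).toLinearMap

/-- The counit of the dual is evaluation at `1`. -/
def counitMap : HopfDual R A →ₗ[R] R :=
  LinearMap.applyₗ (1 : A) ∘ₗ (toDual R A).toLinearMap

/-- The antipode of the dual is the transpose of the antipode. -/
def antipodeMap : HopfDual R A →ₗ[R] HopfDual R A :=
  (toDual R A).symm.toLinearMap ∘ₗ (HopfAlgebra.antipode R (A := A)).dualMap ∘ₗ
    (toDual R A).toLinearMap

variable {R A}

lemma pairing_tmul (f g : HopfDual R A) (a b : A) :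
    pairing R A (f ⊗ₜ g) (a ⊗ₜ b) = toDual R A f a * toDual R A g b := by
  simp [pairing, TensorProduct.dualDistribEquiv, TensorProduct.dualDistribEquivOfBasis]

lemma pairing_comulMap (f : HopfDual R A) (z : A ⊗[R] A) :
    pairing R A (comulMap R A f) z = toDual R A f (LinearMap.mul' R A z) := by
  simp [comulMap]

lemma counitMap_apply (f : HopfDual R A) : counitMap R A f = toDual R A f 1 := rfl

lemma toDual_antipodeMap (f : HopfDual R A) (a : A) :
    toDual R A (antipodeMap R A f) a = toDual R A f (HopfAlgebra.antipode R a) := rfl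

lemma ext_tensor {s t : HopfDual R A ⊗[R] HopfDual R A}
    (h : ∀ a b, pairing R A s (a ⊗ₜ b) = pairing R A t (a ⊗ₜ b)) : s = t := by
  apply (pairing R A).injective
  ext a b
  exact h a b

/-- The identification `A* ⊗ (A* ⊗ A*) ≃ (A ⊗ (A ⊗ A))*`. -/
def pairing₃ : HopfDual R A ⊗[R] (HopfDual R A ⊗[R] HopfDual R A) ≃ₗ[R]
    Module.Dual R (A ⊗[R] (A ⊗[R] A)) :=
  (TensorProduct.congr (toDual R A) (pairing R A)).trans
    (TensorProduct.dualDistribEquiv R A (A ⊗[R] A))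

lemma pairing₃_tmul (f : HopfDual R A) (t : HopfDual R A ⊗[R] HopfDual R A) (a : A)
    (z : A ⊗[R] A) : pairing₃ (f ⊗ₜ t) (a ⊗ₜ z) = toDual R A f a * pairing R A t z := by
  simp [pairing₃, TensorProduct.dualDistribEquiv, TensorProduct.dualDistribEquivOfBasis]

lemma pairing₃_lTensor (t : HopfDual R A ⊗[R] HopfDual R A) (a b c : A) :
    pairing₃ ((comulMap R A).lTensor _ t) (a ⊗ₜ (b ⊗ₜ c)) = pairing R A t (a ⊗ₜ (b * c)) := by
  induction t with
  | zero => simp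
  | add x y hx hy => simp only [map_add, LinearMap.add_apply, hx, hy]
  | tmul f g =>
    rw [LinearMap.lTensor_tmul, pairing₃_tmul, pairing_comulMap, pairing_tmul, LinearMap.mul'_apply]

lemma pairing₃_assoc (t : HopfDual R A ⊗[R] HopfDual R A) (g : HopfDual R A) (a b c : A) :
    pairing₃ (TensorProduct.assoc R _ _ _ (t ⊗ₜ g)) (a ⊗ₜ (b ⊗ₜ c)) =
      pairing R A t (a ⊗ₜ b) * toDual R A g c := by
  induction t with
  | zero => simp
  | add x y hx hy =>
    simp only [TensorProduct.add_tmul, map_add, LinearMap.add_apply, hx, hy, add_mul]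
  | tmul f g =>
    rw [TensorProduct.assoc_tmul, pairing₃_tmul, pairing_tmul, pairing_tmul, mul_assoc]

lemma pairing₃_rTensor (t : HopfDual R A ⊗[R] HopfDual R A) (a b c : A) :
    pairing₃ (TensorProduct.assoc R _ _ _ ((comulMap R A).rTensor _ t)) (a ⊗ₜ (b ⊗ₜ c)) =
      pairing R A t ((a * b) ⊗ₜ c) := by
  induction t with
  | zero => simp
  | add x y hx hy => simp only [map_add, LinearMap.add_apply, hx, hy]
  | tmul f g =>
    rw [LinearMap.rTensor_tmul, pairing₃_assoc, pairing_comulMap, pairing_tmul, LinearMap.mul'_apply]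

lemma counit_rTensor (t : HopfDual R A ⊗[R] HopfDual R A) (a : A) :
    toDual R A (TensorProduct.lid R _ ((counitMap R A).rTensor _ t)) a =
      pairing R A t (1 ⊗ₜ a) := by
  induction t with
  | zero => simp
  | add x y hx hy => simp only [map_add, LinearMap.add_apply, ← hx, ← hy]
  | tmul f g =>
    rw [LinearMap.rTensor_tmul, TensorProduct.lid_tmul, pairing_tmul, counitMap_apply]; simp

lemma counit_lTensor (t : HopfDual R A ⊗[R] HopfDual R A) (a : A) :
    toDual R A (TensorProduct.rid R _ ((counitMap R A).lTensor _ t)) a =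
      pairing R A t (a ⊗ₜ 1) := by
  induction t with
  | zero => simp
  | add x y hx hy => simp only [map_add, LinearMap.add_apply, ← hx, ← hy]
  | tmul f g =>
    rw [LinearMap.lTensor_tmul, TensorProduct.rid_tmul, pairing_tmul, counitMap_apply]
    simp [mul_comm]

instance : Coalgebra R (HopfDual R A) where
  comul := comulMap R A
  counit := counitMap R A
  coassoc := by
    ext1 f
    apply (pairing₃ (R := R) (A := A)).injective
    ext a b c
    simp only [LinearMap.comp_apply, LinearEquiv.coe_coe,
      TensorProduct.AlgebraTensorModule.curry_apply,
      TensorProduct.curry_apply, LinearMap.coe_restrictScalars]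
    rw [pairing₃_rTensor, pairing₃_lTensor, pairing_comulMap, pairing_comulMap]
    simp [mul_assoc]
  rTensor_counit_comp_comul := by
    ext1 f
    apply (TensorProduct.lid R (HopfDual R A)).injective
    apply (toDual R A).injective
    ext a
    simp only [LinearMap.comp_apply, TensorProduct.mk_apply, TensorProduct.lid_tmul, one_smul]
    exact (counit_rTensor _ a).trans (by simp [pairing_comulMap])
  lTensor_counit_comp_comul := by
    ext1 f
    apply (TensorProduct.rid R (HopfDual R A)).injective
    apply (toDual R A).injective
    ext a
    simp only [LinearMap.comp_apply, LinearMap.flip_apply, TensorProduct.mk_apply,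
      TensorProduct.rid_tmul, one_smul]
    exact (counit_lTensor _ a).trans (by simp [pairing_comulMap])

lemma comul_eq (f : HopfDual R A) : Coalgebra.comul (R := R) f = comulMap R A f := rfl
lemma counit_eq (f : HopfDual R A) : Coalgebra.counit (R := R) f = toDual R A f 1 := rfl

lemma pairing_mul (s t : HopfDual R A ⊗[R] HopfDual R A) (a b : A) {ι κ : Type*}
    (ra : Coalgebra.Repr R a ι) (rb : Coalgebra.Repr R b κ) :
    pairing R A (s * t) (a ⊗ₜ b) = ∑ i ∈ ra.index, ∑ j ∈ rb.index,
      pairing R A s (ra.left i ⊗ₜ rb.left j) * pairing R A t (ra.right i ⊗ₜ rb.right j) := by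
  induction s with
  | zero => simp
  | add x y hx hy =>
    simp only [add_mul, map_add, LinearMap.add_apply, hx, hy, Finset.sum_add_distrib]
  | tmul f g =>
    induction t with
    | zero => simp
    | add x y hx hy =>
      simp only [mul_add, map_add, LinearMap.add_apply, hx, hy, Finset.sum_add_distrib]
    | tmul f' g' =>
      rw [Algebra.TensorProduct.tmul_mul_tmul, pairing_tmul, toDual_mul _ _ _ ra,
        toDual_mul _ _ _ rb, Finset.sum_mul_sum]
      refine Finset.sum_congr rfl fun i _ => Finset.sum_congr rfl fun j _ => ?_
      rw [pairing_tmul, pairing_tmul]; ring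

lemma toDual_mul' (f g : HopfDual R A) (a : A) :
    toDual R A (f * g) a = pairing R A (f ⊗ₜ g) (Coalgebra.comul a) := by
  rw [toDual_mul f g a (Coalgebra.Repr.arbitrary R a)]
  conv_rhs => rw [← (Coalgebra.Repr.arbitrary R a).eq]
  simp [pairing_tmul]

instance : Bialgebra R (HopfDual R A) :=
  Bialgebra.mk' R (HopfDual R A)
    (by rw [counit_eq, toDual_one]; simp)
    (by
      intro f g
      simp only [counit_eq]
      rw [toDual_mul', Bialgebra.comul_one, Algebra.TensorProduct.one_def, pairing_tmul])
    (by
      rw [comul_eq]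
      refine ext_tensor fun a b => ?_
      rw [pairing_comulMap, Algebra.TensorProduct.one_def, pairing_tmul]
      simp [toDual_one])
    (by
      intro f g
      simp only [comul_eq]
      refine ext_tensor fun a b => ?_
      rw [pairing_comulMap, pairing_mul _ _ _ _ (Coalgebra.Repr.arbitrary R a)
        (Coalgebra.Repr.arbitrary R b), LinearMap.mul'_apply, toDual_mul', Bialgebra.comul_mul]
      conv_lhs => rw [← (Coalgebra.Repr.arbitrary R a).eq, ← (Coalgebra.Repr.arbitrary R b).eq]
      simp [pairing_comulMap, pairing_tmul, Finset.sum_mul_sum])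

lemma mul'_antipode_rTensor (t : HopfDual R A ⊗[R] HopfDual R A) (a : A) :
    toDual R A (LinearMap.mul' R (HopfDual R A) ((antipodeMap R A).rTensor _ t)) a =
      pairing R A t ((HopfAlgebra.antipode R).rTensor A (Coalgebra.comul a)) := by
  induction t with
  | zero => simp
  | add x y hx hy => simp only [map_add, LinearMap.add_apply, ← hx, ← hy]
  | tmul f g =>
    rw [LinearMap.rTensor_tmul, LinearMap.mul'_apply, toDual_mul _ _ a (Coalgebra.Repr.arbitrary R a)]
    conv_rhs => rw [← (Coalgebra.Repr.arbitrary R a).eq]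
    simp only [map_sum, LinearMap.rTensor_tmul, pairing_tmul, toDual_antipodeMap]

lemma mul'_antipode_lTensor (t : HopfDual R A ⊗[R] HopfDual R A) (a : A) :
    toDual R A (LinearMap.mul' R (HopfDual R A) ((antipodeMap R A).lTensor _ t)) a =
      pairing R A t ((HopfAlgebra.antipode R).lTensor A (Coalgebra.comul a)) := by
  induction t with
  | zero => simp
  | add x y hx hy => simp only [map_add, LinearMap.add_apply, ← hx, ← hy]
  | tmul f g =>
    rw [LinearMap.lTensor_tmul, LinearMap.mul'_apply, toDual_mul _ _ a (Coalgebra.Repr.arbitrary R a)]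
    conv_rhs => rw [← (Coalgebra.Repr.arbitrary R a).eq]
    simp only [map_sum, LinearMap.lTensor_tmul, pairing_tmul, toDual_antipodeMap]

instance : HopfAlgebra R (HopfDual R A) where
  antipode := antipodeMap R A
  mul_antipode_rTensor_comul := by
    ext1 f
    apply (toDual R A).injective
    ext a
    refine (mul'_antipode_rTensor _ a).trans ?_
    rw [comul_eq, pairing_comulMap, HopfAlgebra.mul_antipode_rTensor_comul_apply]
    simp [counit_eq, toDual_one, Algebra.algebraMap_eq_smul_one, mul_comm]
  mul_antipode_lTensor_comul := by
    ext1 f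
    apply (toDual R A).injective
    ext a
    refine (mul'_antipode_lTensor _ a).trans ?_
    rw [comul_eq, pairing_comulMap, HopfAlgebra.mul_antipode_lTensor_comul_apply]
    simp [counit_eq, toDual_one, Algebra.algebraMap_eq_smul_one, mul_comm]

end
end HopfDual
end HopfDual

/-- A subcoalgebra of `C`: a subspace `D` with `Δ(D) ⊆ D ⊗ D`. -/
def IsSubcoalgebra {R C : Type*} [CommRing R] [AddCommGroup C] [Module R C] [Coalgebra R C]
    (D : Submodule R C) : Prop :=
  ∀ x ∈ D, Coalgebra.comul (R := R) x ∈ LinearMap.range (TensorProduct.map D.subtype D.subtype)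

/-- A simple subcoalgebra: nonzero, with no subcoalgebras besides `0` and itself. -/
def IsSimpleSubcoalgebra {R C : Type*} [CommRing R] [AddCommGroup C] [Module R C] [Coalgebra R C]
    (D : Submodule R C) : Prop :=
  IsSubcoalgebra D ∧ D ≠ ⊥ ∧ ∀ E : Submodule R C, IsSubcoalgebra E → E ≤ D → E = ⊥ ∨ E = D

/-- A coalgebra is pointed if all its simple subcoalgebras are one-dimensional. -/
def IsPointed (R C : Type*) [CommRing R] [AddCommGroup C] [Module R C] [Coalgebra R C] : Prop :=
  ∀ D : Submodule R C, IsSimpleSubcoalgebra D → Module.finrank R D = 1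


section Antipode
variable {A : Type*} [Ring A] [Algebra ℂ A]

/-- The linear endomorphism underlying an algebra map into the opposite algebra. -/
def unopMap (S : A →ₐ[ℂ] Aᵐᵒᵖ) : A →ₗ[ℂ] A :=
  (MulOpposite.opLinearEquiv ℂ).symm.toLinearMap ∘ₗ S.toLinearMap

lemma unopMap_apply (S : A →ₐ[ℂ] Aᵐᵒᵖ) (a : A) : unopMap S a = (S a).unop := rfl

lemma unopMap_mul (S : A →ₐ[ℂ] Aᵐᵒᵖ) (a b : A) :
    unopMap S (a * b) = unopMap S b * unopMap S a := by
  simp [unopMap_apply]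

/-- `a ⊗ b ↦ S(a) b`. -/
def leftConv (S : A →ₐ[ℂ] Aᵐᵒᵖ) : A ⊗[ℂ] A →ₗ[ℂ] A :=
  LinearMap.mul' ℂ A ∘ₗ (unopMap S).rTensor A

/-- `a ⊗ b ↦ a S(b)`. -/
def rightConv (S : A →ₐ[ℂ] Aᵐᵒᵖ) : A ⊗[ℂ] A →ₗ[ℂ] A :=
  LinearMap.mul' ℂ A ∘ₗ (unopMap S).lTensor A

lemma leftConv_tmul (S : A →ₐ[ℂ] Aᵐᵒᵖ) (a b : A) :
    leftConv S (a ⊗ₜ b) = unopMap S a * b := by simp [leftConv]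

lemma rightConv_tmul (S : A →ₐ[ℂ] Aᵐᵒᵖ) (a b : A) :
    rightConv S (a ⊗ₜ b) = a * unopMap S b := by simp [rightConv]

lemma leftConv_mul_tmul (S : A →ₐ[ℂ] Aᵐᵒᵖ) (X : A ⊗[ℂ] A) (p q : A) :
    leftConv S (X * (p ⊗ₜ q)) = unopMap S p * leftConv S X * q := by
  induction X with
  | zero => simp
  | add x y hx hy => simp only [add_mul, map_add, hx, hy, mul_add]
  | tmul a b =>
    rw [Algebra.TensorProduct.tmul_mul_tmul, leftConv_tmul, leftConv_tmul, unopMap_mul]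
    simp only [mul_assoc]

lemma rightConv_tmul_mul (S : A →ₐ[ℂ] Aᵐᵒᵖ) (X : A ⊗[ℂ] A) (p q : A) :
    rightConv S ((p ⊗ₜ q) * X) = p * rightConv S X * unopMap S q := by
  induction X with
  | zero => simp
  | add x y hx hy => simp only [mul_add, map_add, hx, hy, add_mul]
  | tmul a b =>
    rw [Algebra.TensorProduct.tmul_mul_tmul, rightConv_tmul, rightConv_tmul, unopMap_mul]
    simp only [mul_assoc]

lemma leftConv_mul (S : A →ₐ[ℂ] Aᵐᵒᵖ) (X Y : A ⊗[ℂ] A) (c : ℂ)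
    (hX : leftConv S X = algebraMap ℂ A c) : leftConv S (X * Y) = c • leftConv S Y := by
  induction Y with
  | zero => simp
  | add x y hx hy => simp only [mul_add, map_add, hx, hy, smul_add]
  | tmul a b =>
    rw [leftConv_mul_tmul, hX, leftConv_tmul, Algebra.algebraMap_eq_smul_one]; simp

lemma rightConv_mul (S : A →ₐ[ℂ] Aᵐᵒᵖ) (X Y : A ⊗[ℂ] A) (c : ℂ)
    (hY : rightConv S Y = algebraMap ℂ A c) : rightConv S (X * Y) = c • rightConv S X := by
  induction X with
  | zero => simp
  | add x y hx hy => simp only [add_mul, map_add, hx, hy, smul_add]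
  | tmul a b =>
    rw [rightConv_tmul_mul, hY, rightConv_tmul, Algebra.algebraMap_eq_smul_one]; simp

end Antipode

section Lifting

/-- The data defining a lifting of a quantum plane over the abelian group `Γ` in which both
skew-primitive generators carry the same character. -/
structure LiftingDatum (Γ : Type*) [CommGroup Γ] where
  g : Fin 2 → Γ
  χ : Γ →* ℂ
  χ_g : ∀ i, χ (g i) = -1
  lam₁ : ℂ
  lam₂ : ℂ
  lam₃ : ℂ

variable {Γ : Type*} [CommGroup Γ]

/-- The defining relations, in the free algebra on symbols `γ ∈ Γ` and `x₁, x₂`. -/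
inductive LiftingDatum.Rel (D : LiftingDatum Γ) :
    FreeAlgebra ℂ (Γ ⊕ Fin 2) → FreeAlgebra ℂ (Γ ⊕ Fin 2) → Prop
  | one : D.Rel (FreeAlgebra.ι ℂ (Sum.inl 1)) 1
  | mul (γ δ : Γ) : D.Rel (FreeAlgebra.ι ℂ (Sum.inl (γ * δ)))
      (FreeAlgebra.ι ℂ (Sum.inl γ) * FreeAlgebra.ι ℂ (Sum.inl δ))
  | conj (γ : Γ) (i : Fin 2) :
      D.Rel (FreeAlgebra.ι ℂ (Sum.inl γ) * FreeAlgebra.ι ℂ (Sum.inr i))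
        (D.χ γ • (FreeAlgebra.ι ℂ (Sum.inr i) * FreeAlgebra.ι ℂ (Sum.inl γ)))
  | sq₁ : D.Rel (FreeAlgebra.ι ℂ (Sum.inr 0) * FreeAlgebra.ι ℂ (Sum.inr 0))
      (D.lam₁ • (1 - FreeAlgebra.ι ℂ (Sum.inl (D.g 0 * D.g 0))))
  | sq₂ : D.Rel (FreeAlgebra.ι ℂ (Sum.inr 1) * FreeAlgebra.ι ℂ (Sum.inr 1))
      (D.lam₂ • (1 - FreeAlgebra.ι ℂ (Sum.inl (D.g 1 * D.g 1))))
  | link : D.Rel (FreeAlgebra.ι ℂ (Sum.inr 0) * FreeAlgebra.ι ℂ (Sum.inr 1) +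
        FreeAlgebra.ι ℂ (Sum.inr 1) * FreeAlgebra.ι ℂ (Sum.inr 0))
      (D.lam₃ • (1 - FreeAlgebra.ι ℂ (Sum.inl (D.g 0 * D.g 1))))

/-- The algebra generated by the group `Γ` and `x₁, x₂` with relations
`γ xᵢ = χ(γ) xᵢ γ`, `x₁² = λ₁ (1 - g₁²)`, `x₂² = λ₂ (1 - g₂²)`,
`x₁ x₂ + x₂ x₁ = λ₃ (1 - g₁ g₂)`. -/
def Lifting (D : LiftingDatum Γ) : Type _ := RingQuot D.Rel

namespace Lifting

variable (D : LiftingDatum Γ)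

instance : Ring (Lifting D) := inferInstanceAs (Ring (RingQuot D.Rel))
instance : Algebra ℂ (Lifting D) := inferInstanceAs (Algebra ℂ (RingQuot D.Rel))

/-- The quotient map from the free algebra. -/
def mk : FreeAlgebra ℂ (Γ ⊕ Fin 2) →ₐ[ℂ] Lifting D := RingQuot.mkAlgHom ℂ D.Rel

/-- The group elements in the algebra. -/
def of : Γ →* Lifting D where
  toFun γ := mk D (FreeAlgebra.ι ℂ (Sum.inl γ))
  map_one' := (RingQuot.mkAlgHom_rel ℂ (LiftingDatum.Rel.one (D := D))).trans (map_one (mk D))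
  map_mul' γ δ :=
    (RingQuot.mkAlgHom_rel ℂ (LiftingDatum.Rel.mul (D := D) γ δ)).trans (map_mul (mk D) _ _)

/-- The generators `x₁, x₂`. -/
def x (i : Fin 2) : Lifting D := mk D (FreeAlgebra.ι ℂ (Sum.inr i))

lemma of_mul_x (γ : Γ) (i : Fin 2) : of D γ * x D i = D.χ γ • (x D i * of D γ) := by
  have h := RingQuot.mkAlgHom_rel ℂ (LiftingDatum.Rel.conj (D := D) γ i)
  change mk D _ = mk D _ at h
  rwa [map_mul, map_smul, map_mul] at h

lemma x_sq₁ : x D 0 * x D 0 = D.lam₁ • (1 - of D (D.g 0) * of D (D.g 0)) := by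
  have h := RingQuot.mkAlgHom_rel ℂ (LiftingDatum.Rel.sq₁ (D := D))
  change mk D _ = mk D _ at h
  rw [← map_mul (of D)]
  rwa [map_mul, map_smul, map_sub, map_one] at h

lemma x_sq₂ : x D 1 * x D 1 = D.lam₂ • (1 - of D (D.g 1) * of D (D.g 1)) := by
  have h := RingQuot.mkAlgHom_rel ℂ (LiftingDatum.Rel.sq₂ (D := D))
  change mk D _ = mk D _ at h
  rw [← map_mul (of D)]
  rwa [map_mul, map_smul, map_sub, map_one] at h

lemma x_link :
    x D 0 * x D 1 + x D 1 * x D 0 = D.lam₃ • (1 - of D (D.g 0) * of D (D.g 1)) := by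
  have h := RingQuot.mkAlgHom_rel ℂ (LiftingDatum.Rel.link (D := D))
  change mk D _ = mk D _ at h
  rw [← map_mul (of D)]
  rwa [map_add, map_mul, map_mul, map_smul, map_sub, map_one] at h

variable {D} {B : Type*} [Ring B] [Algebra ℂ B]

/-- The universal property of the presentation. -/
def lift (f : Γ →* B) (y : Fin 2 → B) (hc : ∀ γ i, f γ * y i = D.χ γ • (y i * f γ))
    (h₁ : y 0 * y 0 = D.lam₁ • (1 - f (D.g 0) * f (D.g 0)))
    (h₂ : y 1 * y 1 = D.lam₂ • (1 - f (D.g 1) * f (D.g 1)))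
    (h₃ : y 0 * y 1 + y 1 * y 0 = D.lam₃ • (1 - f (D.g 0) * f (D.g 1))) :
    Lifting D →ₐ[ℂ] B :=
  RingQuot.liftAlgHom ℂ ⟨FreeAlgebra.lift ℂ (Sum.elim f y), by
    intro a b h
    cases h <;> simp [hc, h₁, h₂, h₃]⟩

section
variable (f : Γ →* B) (y : Fin 2 → B) (hc : ∀ γ i, f γ * y i = D.χ γ • (y i * f γ))
    (h₁ : y 0 * y 0 = D.lam₁ • (1 - f (D.g 0) * f (D.g 0)))
    (h₂ : y 1 * y 1 = D.lam₂ • (1 - f (D.g 1) * f (D.g 1)))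
    (h₃ : y 0 * y 1 + y 1 * y 0 = D.lam₃ • (1 - f (D.g 0) * f (D.g 1)))

lemma lift_of (γ : Γ) : lift f y hc h₁ h₂ h₃ (of D γ) = f γ :=
  (RingQuot.liftAlgHom_mkAlgHom_apply ℂ _ _ _).trans (by simp)

lemma lift_x (i : Fin 2) : lift f y hc h₁ h₂ h₃ (x D i) = y i :=
  (RingQuot.liftAlgHom_mkAlgHom_apply ℂ _ _ _).trans (by simp)
end

lemma algHom_ext {f g : Lifting D →ₐ[ℂ] B} (h : ∀ γ, f (of D γ) = g (of D γ))
    (h' : ∀ i, f (x D i) = g (x D i)) : f = g := by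
  refine RingQuot.ringQuot_ext' ℂ f g (FreeAlgebra.hom_ext (funext fun s => ?_))
  rcases s with γ | i
  · exact h γ
  · exact h' i

lemma induction {p : Lifting D → Prop} (hof : ∀ γ, p (of D γ)) (hx : ∀ i, p (x D i))
    (hs : ∀ c : ℂ, p (algebraMap ℂ _ c)) (ha : ∀ a b, p a → p b → p (a + b))
    (hm : ∀ a b, p a → p b → p (a * b)) (a : Lifting D) : p a := by
  obtain ⟨a, rfl⟩ := RingQuot.mkAlgHom_surjective ℂ D.Rel a
  change p (mk D a)
  induction a using FreeAlgebra.induction with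
  | grade0 c => rw [AlgHom.commutes]; exact hs c
  | grade1 s => rcases s with γ | i; exacts [hof γ, hx i]
  | mul a b h1 h2 => rw [map_mul]; exact hm _ _ h1 h2
  | add a b h1 h2 => rw [map_add]; exact ha _ _ h1 h2

variable (D)

/-- `γ ↦ γ ⊗ γ`. -/
def ofTensor : Γ →* Lifting D ⊗[ℂ] Lifting D where
  toFun γ := of D γ ⊗ₜ of D γ
  map_one' := by rw [map_one, Algebra.TensorProduct.one_def]
  map_mul' γ δ := by rw [map_mul, Algebra.TensorProduct.tmul_mul_tmul]

/-- `xᵢ ⊗ 1 + gᵢ ⊗ xᵢ`. -/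
def xTensor (i : Fin 2) : Lifting D ⊗[ℂ] Lifting D := x D i ⊗ₜ 1 + of D (D.g i) ⊗ₜ x D i

lemma of_g_mul_x (i j : Fin 2) : of D (D.g i) * x D j = - (x D j * of D (D.g i)) := by
  rw [of_mul_x, D.χ_g, neg_one_smul]

lemma xTensor_anticomm (i j : Fin 2) :
    xTensor D i * xTensor D j + xTensor D j * xTensor D i =
      (x D i * x D j + x D j * x D i) ⊗ₜ 1 +
        (of D (D.g i) * of D (D.g j)) ⊗ₜ (x D i * x D j + x D j * x D i) := by
  have hg : of D (D.g j) * of D (D.g i) = of D (D.g i) * of D (D.g j) := by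
    rw [← map_mul, ← map_mul, mul_comm]
  simp only [xTensor, add_mul, mul_add, Algebra.TensorProduct.tmul_mul_tmul, mul_one, one_mul,
    of_g_mul_x, TensorProduct.add_tmul, TensorProduct.tmul_add, TensorProduct.neg_tmul, hg]
  abel

lemma xTensor_sq (i : Fin 2) : xTensor D i * xTensor D i =
      (x D i * x D i) ⊗ₜ 1 + (of D (D.g i) * of D (D.g i)) ⊗ₜ (x D i * x D i) := by
  simp only [xTensor, add_mul, mul_add, Algebra.TensorProduct.tmul_mul_tmul, mul_one, one_mul,
    of_g_mul_x, TensorProduct.neg_tmul]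
  abel

/-- `Δ(γ) = γ ⊗ γ`, `Δ(xᵢ) = xᵢ ⊗ 1 + gᵢ ⊗ xᵢ`. -/
def comulHom : Lifting D →ₐ[ℂ] Lifting D ⊗[ℂ] Lifting D :=
  lift (ofTensor D) (xTensor D)
    (by
      intro γ i
      have hg : of D γ * of D (D.g i) = of D (D.g i) * of D γ := by
        rw [← map_mul, ← map_mul, mul_comm]
      simp [ofTensor, xTensor, mul_add, add_mul, of_mul_x, TensorProduct.smul_tmul', hg])
    (by
      rw [xTensor_sq, x_sq₁]
      simp [ofTensor, Algebra.TensorProduct.one_def, TensorProduct.smul_tmul', TensorProduct.sub_tmul,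
        TensorProduct.tmul_sub, smul_sub])
    (by
      rw [xTensor_sq, x_sq₂]
      simp [ofTensor, Algebra.TensorProduct.one_def, TensorProduct.smul_tmul', TensorProduct.sub_tmul,
        TensorProduct.tmul_sub, smul_sub])
    (by
      rw [xTensor_anticomm, x_link]
      simp [ofTensor, Algebra.TensorProduct.one_def, TensorProduct.smul_tmul', TensorProduct.sub_tmul,
        TensorProduct.tmul_sub, smul_sub])

/-- `ε(γ) = 1`, `ε(xᵢ) = 0`. -/
def counitHom : Lifting D →ₐ[ℂ] ℂ :=
  lift 1 0 (by simp) (by simp) (by simp) (by simp)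

/-- `-gᵢ⁻¹ xᵢ`. -/
def xAnti (i : Fin 2) : Lifting D := -(of D (D.g i)⁻¹ * x D i)

lemma χ_g_inv (i : Fin 2) : D.χ (D.g i)⁻¹ = -1 := by
  have h : D.χ (D.g i)⁻¹ * D.χ (D.g i) = 1 := by rw [← map_mul, inv_mul_cancel, map_one]
  rw [D.χ_g] at h
  linear_combination -h

lemma x_mul_of_g_inv (i j : Fin 2) :
    x D j * of D (D.g i)⁻¹ = -(of D (D.g i)⁻¹ * x D j) := by
  rw [of_mul_x, χ_g_inv, neg_one_smul, neg_neg]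

lemma xAnti_mul (i j : Fin 2) :
    xAnti D i * xAnti D j = -(of D ((D.g i)⁻¹ * (D.g j)⁻¹) * (x D i * x D j)) := by
  rw [xAnti, xAnti, neg_mul_neg, mul_assoc, ← mul_assoc (x D i), x_mul_of_g_inv, map_mul]
  simp only [mul_assoc, neg_mul, mul_neg]

lemma of_inv_mul (c : ℂ) (γ δ : Γ) :
    -(of D (γ⁻¹ * δ⁻¹) * (c • (1 - of D γ * of D δ))) = c • (1 - of D γ⁻¹ * of D δ⁻¹) := by
  have h : of D (γ⁻¹ * δ⁻¹) * (of D γ * of D δ) = 1 := by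
    rw [← map_mul, ← map_mul, mul_mul_mul_comm, inv_mul_cancel, inv_mul_cancel, mul_one, map_one]
  rw [mul_smul_comm, mul_sub, h, mul_one, ← smul_neg, neg_sub, map_mul]

/-- `γ ↦ γ⁻¹`, as a map into the opposite algebra. -/
def ofAnti : Γ →* (Lifting D)ᵐᵒᵖ where
  toFun γ := MulOpposite.op (of D γ⁻¹)
  map_one' := by simp
  map_mul' γ δ := by rw [← MulOpposite.op_mul, ← map_mul, mul_inv_rev]

/-- `S(γ) = γ⁻¹`, `S(xᵢ) = -gᵢ⁻¹ xᵢ`, as an algebra map into the opposite algebra. -/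
def antipodeHom : Lifting D →ₐ[ℂ] (Lifting D)ᵐᵒᵖ :=
  lift (ofAnti D) (fun i => MulOpposite.op (xAnti D i))
    (by
      intro γ i
      apply MulOpposite.unop_injective
      change xAnti D i * of D γ⁻¹ = D.χ γ • (of D γ⁻¹ * xAnti D i)
      have h : D.χ γ * D.χ γ⁻¹ = 1 := by rw [← map_mul, mul_inv_cancel, map_one]
      have hg : of D γ⁻¹ * of D (D.g i)⁻¹ = of D (D.g i)⁻¹ * of D γ⁻¹ := by
        rw [← map_mul, ← map_mul, mul_comm]
      rw [xAnti, mul_neg, ← mul_assoc, hg, mul_assoc, of_mul_x D γ⁻¹, mul_smul_comm, smul_neg, smul_smul,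
        h, one_smul, neg_mul, mul_assoc])
    (by
      apply MulOpposite.unop_injective
      change xAnti D 0 * xAnti D 0 = D.lam₁ • (1 - of D (D.g 0)⁻¹ * of D (D.g 0)⁻¹)
      rw [xAnti_mul, x_sq₁, of_inv_mul])
    (by
      apply MulOpposite.unop_injective
      change xAnti D 1 * xAnti D 1 = D.lam₂ • (1 - of D (D.g 1)⁻¹ * of D (D.g 1)⁻¹)
      rw [xAnti_mul, x_sq₂, of_inv_mul])
    (by
      apply MulOpposite.unop_injective
      change xAnti D 1 * xAnti D 0 + xAnti D 0 * xAnti D 1 =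
        D.lam₃ • (1 - of D (D.g 1)⁻¹ * of D (D.g 0)⁻¹)
      rw [xAnti_mul, xAnti_mul, mul_comm (D.g 0)⁻¹, ← neg_add, ← mul_add, add_comm (x D 1 * x D 0),
        x_link, ← of_inv_mul, ← map_mul, ← map_mul, mul_comm (D.g 0)])

lemma comulHom_of (γ : Γ) : comulHom D (of D γ) = of D γ ⊗ₜ of D γ := lift_of _ _ _ _ _ _ _

lemma comulHom_x (i : Fin 2) : comulHom D (x D i) = x D i ⊗ₜ 1 + of D (D.g i) ⊗ₜ x D i :=
  lift_x _ _ _ _ _ _ _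

lemma counitHom_of (γ : Γ) : counitHom D (of D γ) = 1 := lift_of _ _ _ _ _ _ _

lemma counitHom_x (i : Fin 2) : counitHom D (x D i) = 0 := lift_x _ _ _ _ _ _ _

instance : Bialgebra ℂ (Lifting D) :=
  Bialgebra.ofAlgHom (comulHom D) (counitHom D)
    (by
      refine algHom_ext (fun γ => ?_) (fun i => ?_)
      · simp [comulHom_of]
      · simp [comulHom_of, comulHom_x, TensorProduct.add_tmul, TensorProduct.tmul_add,
          Algebra.TensorProduct.one_def, add_assoc])
    (by
      refine algHom_ext (fun γ => ?_) (fun i => ?_)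
      · simp [comulHom_of, counitHom_of]
      · simp [comulHom_x, counitHom_of, counitHom_x])
    (by
      refine algHom_ext (fun γ => ?_) (fun i => ?_)
      · simp [comulHom_of, counitHom_of]
      · simp [comulHom_x, counitHom_of, counitHom_x])

lemma comul_eq (a : Lifting D) : Coalgebra.comul (R := ℂ) a = comulHom D a := rfl
lemma counit_eq (a : Lifting D) : Coalgebra.counit (R := ℂ) a = counitHom D a := rfl

lemma antipodeHom_of (γ : Γ) : unopMap (antipodeHom D) (of D γ) = of D γ⁻¹ :=
  congrArg MulOpposite.unop (lift_of (ofAnti D) _ _ _ _ _ γ)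

lemma antipodeHom_x (i : Fin 2) : unopMap (antipodeHom D) (x D i) = xAnti D i :=
  congrArg MulOpposite.unop (lift_x (ofAnti D) (fun i => MulOpposite.op (xAnti D i)) _ _ _ _ i)

lemma unopMap_one : unopMap (antipodeHom D) 1 = 1 := by simp [unopMap_apply]

lemma leftConv_comul (a : Lifting D) :
    leftConv (antipodeHom D) (comulHom D a) = algebraMap ℂ _ (counitHom D a) := by
  induction a using induction with
  | hof γ =>
    rw [comulHom_of, leftConv_tmul, antipodeHom_of, counitHom_of, ← map_mul, inv_mul_cancel]; simp
  | hx i =>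
    rw [comulHom_x, map_add, leftConv_tmul, leftConv_tmul, antipodeHom_of, antipodeHom_x,
      counitHom_x, xAnti]; simp
  | hs c =>
    rw [AlgHom.commutes, AlgHom.commutes, Algebra.TensorProduct.algebraMap_apply, leftConv_tmul,
      Algebra.algebraMap_eq_smul_one, map_smul, unopMap_one]; simp [Algebra.algebraMap_eq_smul_one]
  | ha a b h1 h2 => simp only [map_add, h1, h2]
  | hm a b h1 h2 =>
    rw [map_mul, leftConv_mul _ _ _ _ h1, h2, map_mul, map_mul, Algebra.smul_def]

lemma rightConv_comul (a : Lifting D) :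
    rightConv (antipodeHom D) (comulHom D a) = algebraMap ℂ _ (counitHom D a) := by
  induction a using induction with
  | hof γ =>
    rw [comulHom_of, rightConv_tmul, antipodeHom_of, counitHom_of, ← map_mul, mul_inv_cancel]; simp
  | hx i =>
    rw [comulHom_x, map_add, rightConv_tmul, rightConv_tmul, antipodeHom_x, unopMap_one,
      counitHom_x, xAnti, mul_neg, ← mul_assoc, ← map_mul, mul_inv_cancel]; simp
  | hs c =>
    rw [AlgHom.commutes, AlgHom.commutes, Algebra.TensorProduct.algebraMap_apply, rightConv_tmul,
      unopMap_one]; simp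
  | ha a b h1 h2 => simp only [map_add, h1, h2]
  | hm a b h1 h2 =>
    rw [map_mul, rightConv_mul _ _ _ _ h2, h1, map_mul, map_mul, Algebra.smul_def,
      Algebra.commutes]

instance : HopfAlgebra ℂ (Lifting D) where
  antipode := unopMap (antipodeHom D)
  mul_antipode_rTensor_comul := LinearMap.ext (leftConv_comul D)
  mul_antipode_lTensor_comul := LinearMap.ext (rightConv_comul D)

end Lifting
end Lifting
section Exp

/-- The exponential `∑ aⁱ / i!` of a nilpotent element. -/
def nexp {X : Type*} [Ring X] [Algebra ℂ X] (a : X) : X :=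
  ∑ i ∈ Finset.range (nilpotencyClass a), ((i.factorial : ℂ)⁻¹) • a ^ i

variable {X Y : Type*} [Ring X] [Algebra ℂ X] [Ring Y] [Algebra ℂ Y]

lemma nexp_eq (a : X) :
    letI : Module ℚ X := Module.compHom X (algebraMap ℚ ℂ)
    nexp a = IsNilpotent.exp a := by
  let _ : Module ℚ X := Module.compHom X (algebraMap ℚ ℂ)
  refine Finset.sum_congr rfl fun i _ => ?_
  change _ = (algebraMap ℚ ℂ ((i.factorial : ℚ)⁻¹)) • a ^ i
  simp

lemma nexp_add {a b : X} (h : Commute a b) (ha : IsNilpotent a) (hb : IsNilpotent b) :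
    nexp (a + b) = nexp a * nexp b := by
  let _ : Module ℚ X := Module.compHom X (algebraMap ℚ ℂ)
  rw [nexp_eq, nexp_eq, nexp_eq]
  exact IsNilpotent.exp_add_of_commute h ha hb

lemma nexp_eq_sum {a : X} {k : ℕ} (h : a ^ k = 0) :
    nexp a = ∑ i ∈ Finset.range k, ((i.factorial : ℂ)⁻¹) • a ^ i := by
  let _ : Module ℚ X := Module.compHom X (algebraMap ℚ ℂ)
  rw [nexp_eq, IsNilpotent.exp_eq_sum h]
  refine Finset.sum_congr rfl fun i _ => ?_
  change (algebraMap ℚ ℂ ((i.factorial : ℚ)⁻¹)) • a ^ i = _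
  simp

lemma nexp_zero : nexp (0 : X) = 1 := by
  rw [nexp_eq_sum (k := 1) (by simp)]; simp

lemma map_nexp (f : X →ₐ[ℂ] Y) {a : X} (ha : IsNilpotent a) : f (nexp a) = nexp (f a) := by
  obtain ⟨k, hk⟩ := ha
  rw [nexp_eq_sum hk, nexp_eq_sum (k := k) (by rw [← map_pow, hk, map_zero])]
  simp

lemma nexp_mul_neg {a : X} (ha : IsNilpotent a) : nexp a * nexp (-a) = 1 := by
  rw [← nexp_add (Commute.neg_right (Commute.refl a)) ha ha.neg, add_neg_cancel, nexp_zero]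

lemma nexp_neg_mul {a : X} (ha : IsNilpotent a) : nexp (-a) * nexp a = 1 := by
  rw [← nexp_add (Commute.neg_left (Commute.refl a)) ha.neg ha, neg_add_cancel, nexp_zero]

lemma exists_nexp_eq {a : X} (ha : IsNilpotent a) :
    ∃ q, nexp a = 1 + a * q ∧ nexp a = 1 + q * a := by
  obtain ⟨k, hk⟩ := ha
  have h := nexp_eq_sum (k := k + 1) (a := a) (by rw [pow_succ, hk, zero_mul])
  rw [Finset.sum_range_succ'] at h
  refine ⟨∑ i ∈ Finset.range k, (((i + 1).factorial : ℂ)⁻¹) • a ^ i, ?_, ?_⟩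
  · rw [h, Finset.mul_sum, add_comm]
    simp [pow_succ']
  · rw [h, Finset.sum_mul, add_comm]
    simp [pow_succ]

end Exp

section EG

variable {G V : Type*} [Group G] [AddCommGroup V] [Module ℂ V]

/-- The exterior algebra `ΛV` of a representation of `G`, with `G` acting by algebra
automorphisms. -/
def Lambda (_ρ : Representation ℂ G V) : Type _ := ExteriorAlgebra ℂ V

namespace Lambda
variable (ρ : Representation ℂ G V)

instance : Ring (Lambda ρ) := inferInstanceAs (Ring (ExteriorAlgebra ℂ V))
instance : Algebra ℂ (Lambda ρ) := inferInstanceAs (Algebra ℂ (ExteriorAlgebra ℂ V))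

instance : MulSemiringAction G (Lambda ρ) where
  smul g x := (ExteriorAlgebra.map (ρ g) : ExteriorAlgebra ℂ V →ₐ[ℂ] ExteriorAlgebra ℂ V) x
  one_smul x := by
    change ExteriorAlgebra.map (ρ 1) x = x
    rw [map_one, Module.End.one_eq_id, ExteriorAlgebra.map_id]; rfl
  mul_smul g h x := by
    change ExteriorAlgebra.map (ρ (g * h)) x =
      ExteriorAlgebra.map (ρ g) (ExteriorAlgebra.map (ρ h) x)
    rw [map_mul, Module.End.mul_eq_comp, ← ExteriorAlgebra.map_comp_map]; rfl
  smul_zero g := map_zero (ExteriorAlgebra.map (ρ g))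
  smul_add g := map_add (ExteriorAlgebra.map (ρ g))
  smul_one g := map_one (ExteriorAlgebra.map (ρ g))
  smul_mul g := map_mul (ExteriorAlgebra.map (ρ g))

instance : SMulCommClass G ℂ (Lambda ρ) where
  smul_comm g c x := map_smul (ExteriorAlgebra.map (ρ g)) c x

instance [FiniteDimensional ℂ V] : Module.Finite ℂ (Lambda ρ) :=
  Module.Finite.of_basis (Module.finBasis ℂ V).ExteriorAlgebra

/-- The inclusion of the generators. -/
def ι : V →ₗ[ℂ] Lambda ρ := (ExteriorAlgebra.ι ℂ : V →ₗ[ℂ] ExteriorAlgebra ℂ V)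

lemma smul_ι (g : G) (v : V) : g • ι ρ v = ι ρ (ρ g v) := ExteriorAlgebra.map_apply_ι (ρ g) v

lemma ι_sq (v : V) : ι ρ v * ι ρ v = 0 := ExteriorAlgebra.ι_sq_zero v

variable {ρ}

lemma induction {p : Lambda ρ → Prop} (hs : ∀ c : ℂ, p (algebraMap ℂ _ c)) (hι : ∀ v, p (ι ρ v))
    (hm : ∀ a b, p a → p b → p (a * b)) (ha : ∀ a b, p a → p b → p (a + b)) (a : Lambda ρ) : p a :=
  ExteriorAlgebra.induction (C := p) hs hι hm ha a

variable {R : Type*} [Ring R] [Algebra ℂ R]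

/-- The universal property of `ΛV`. -/
def lift (j : V →ₗ[ℂ] R) (hj : ∀ v, j v * j v = 0) : Lambda ρ →ₐ[ℂ] R :=
  (ExteriorAlgebra.lift ℂ ⟨j, hj⟩ : ExteriorAlgebra ℂ V →ₐ[ℂ] R)

lemma lift_ι (j : V →ₗ[ℂ] R) (hj : ∀ v, j v * j v = 0) (v : V) :
    lift j hj (ι ρ v) = j v := ExteriorAlgebra.lift_ι_apply ℂ j hj v

end Lambda

/-- The input of the construction: a representation `V` of `G`, a central element `u ∈ G` with
`u² = 1` acting by `-1` on `V`, and a symmetric tensor `B ∈ S²V`. -/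
structure TwistDatum (G V : Type*) [Group G] [AddCommGroup V] [Module ℂ V] where
  ρ : Representation ℂ G V
  u : G
  u_central : ∀ g, u * g = g * u
  u_sq : u * u = 1
  ρ_u : ∀ v, ρ u v = -v
  B : V ⊗[ℂ] V
  B_symm : TensorProduct.comm ℂ V V B = B

/-- The Hopf algebra `A(G, V, u, B)`. Its underlying algebra is `ℂ[G] ⋉ ΛV`. -/
def EGAlgebra (D : TwistDatum G V) : Type _ := SkewMonoidAlgebra (Lambda D.ρ) G

namespace EGAlgebra
variable (D : TwistDatum G V)

instance : Ring (EGAlgebra D) := inferInstanceAs (Ring (SkewMonoidAlgebra (Lambda D.ρ) G))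
instance : Algebra ℂ (EGAlgebra D) :=
  inferInstanceAs (Algebra ℂ (SkewMonoidAlgebra (Lambda D.ρ) G))

lemma finite_skewMonoidAlgebra (k H : Type*) [AddCommGroup k] [Module ℂ k] [Module.Finite ℂ k]
    [Finite H] : Module.Finite ℂ (SkewMonoidAlgebra k H) :=
  Module.Finite.of_surjective
    ({ toFun := fun f => ⟨f⟩, map_add' := fun _ _ => SkewMonoidAlgebra.ofCoeff_add,
       map_smul' := fun c f => SkewMonoidAlgebra.ofCoeff_smul c f } :
      (H →₀ k) →ₗ[ℂ] SkewMonoidAlgebra k H) (fun f => ⟨f.coeff, rfl⟩)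

instance [Finite G] [FiniteDimensional ℂ V] : Module.Finite ℂ (EGAlgebra D) :=
  finite_skewMonoidAlgebra (Lambda D.ρ) G

/-- The embedding of `G`. -/
def of : G →* EGAlgebra D := SkewMonoidAlgebra.of (Lambda D.ρ) G

/-- The embedding of `ΛV`. -/
def incl : Lambda D.ρ →ₐ[ℂ] EGAlgebra D where
  toRingHom := SkewMonoidAlgebra.singleOneRingHom
  commutes' _ := rfl

/-- The embedding of `V`. -/
def ι : V →ₗ[ℂ] EGAlgebra D := (incl D).toLinearMap ∘ₗ Lambda.ι D.ρ

lemma ι_apply (v : V) : ι D v = incl D (Lambda.ι D.ρ v) := rfl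

lemma single_comm (g : G) (x : Lambda D.ρ) :
    (SkewMonoidAlgebra.single g 1 * SkewMonoidAlgebra.single 1 x :
      SkewMonoidAlgebra (Lambda D.ρ) G) =
    SkewMonoidAlgebra.single 1 (g • x) * SkewMonoidAlgebra.single g 1 := by
  rw [SkewMonoidAlgebra.single_mul_single, SkewMonoidAlgebra.single_mul_single]
  simp

lemma of_mul_incl (g : G) (x : Lambda D.ρ) : of D g * incl D x = incl D (g • x) * of D g :=
  single_comm D g x

lemma of_mul_ι (g : G) (v : V) : of D g * ι D v = ι D (D.ρ g v) * of D g := by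
  rw [ι_apply, of_mul_incl, Lambda.smul_ι, ι_apply]

lemma ι_sq (v : V) : ι D v * ι D v = 0 := by
  rw [ι_apply, ← map_mul, Lambda.ι_sq, map_zero]

lemma ι_anticomm (v w : V) : ι D v * ι D w = -(ι D w * ι D v) := by
  have h := ι_sq D (v + w)
  rw [map_add, add_mul, mul_add, mul_add, ι_sq, ι_sq, zero_add, add_zero] at h
  exact eq_neg_of_add_eq_zero_left h

lemma u_mul_ι (v : V) : of D D.u * ι D v = -(ι D v * of D D.u) := by
  rw [of_mul_ι, D.ρ_u, map_neg, neg_mul]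

lemma u_mul_u : of D D.u * of D D.u = 1 := by rw [← map_mul, D.u_sq, map_one]

variable {D} {R : Type*} [Ring R] [Algebra ℂ R]

/-- The universal property of `ℂ[G] ⋉ ΛV`. -/
def lift (f : G →* R) (j : V →ₗ[ℂ] R) (hj : ∀ v, j v * j v = 0)
    (hc : ∀ g v, f g * j v = j (D.ρ g v) * f g) : EGAlgebra D →ₐ[ℂ] R :=
  SkewMonoidAlgebra.liftNCAlgHom (Lambda.lift (ρ := D.ρ) j hj) f (by
      intro x g
      induction x using Lambda.induction with
      | hs r => rw [smul_algebraMap, AlgHom.commutes, Algebra.commutes]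
      | hι v => rw [Lambda.smul_ι, Lambda.lift_ι, Lambda.lift_ι, hc]
      | hm a b ha hb => rw [smul_mul', map_mul, map_mul, mul_assoc, hb, ← mul_assoc, ha, mul_assoc]
      | ha a b ha hb => rw [smul_add, map_add, map_add, add_mul, mul_add, ha, hb])

section
variable (f : G →* R) (j : V →ₗ[ℂ] R) (hj : ∀ v, j v * j v = 0)
    (hc : ∀ g v, f g * j v = j (D.ρ g v) * f g)

lemma lift_of (g : G) : lift f j hj hc (of D g) = f g := by
  refine (SkewMonoidAlgebra.liftNC_single _ _ g (1 : Lambda D.ρ)).trans ?_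
  change Lambda.lift (ρ := D.ρ) j hj 1 * f g = f g
  rw [map_one, one_mul]

lemma lift_ι (v : V) : lift f j hj hc (ι D v) = j v := by
  refine (SkewMonoidAlgebra.liftNC_single _ _ 1 (Lambda.ι D.ρ v)).trans ?_
  change Lambda.lift (ρ := D.ρ) j hj (Lambda.ι D.ρ v) * f 1 = j v
  rw [map_one, mul_one, Lambda.lift_ι]
end

lemma single_eq (g : G) (x : Lambda D.ρ) :
    (SkewMonoidAlgebra.single g x : SkewMonoidAlgebra (Lambda D.ρ) G) =
      SkewMonoidAlgebra.single 1 x * SkewMonoidAlgebra.single g 1 := by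
  rw [SkewMonoidAlgebra.single_mul_single]; simp

lemma induction {p : EGAlgebra D → Prop} (hof : ∀ g, p (of D g)) (hι : ∀ v, p (ι D v))
    (hs : ∀ c : ℂ, p (algebraMap ℂ _ c)) (ha : ∀ a b, p a → p b → p (a + b))
    (hm : ∀ a b, p a → p b → p (a * b)) (a : EGAlgebra D) : p a := by
  have h0 : ∀ x : Lambda D.ρ, p (incl D x) := by
    intro x
    induction x using Lambda.induction with
    | hs r => rw [AlgHom.commutes]; exact hs r
    | hι v => exact hι v
    | hm a b h1 h2 => rw [map_mul]; exact hm _ _ h1 h2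
    | ha a b h1 h2 => rw [map_add]; exact ha _ _ h1 h2
  refine SkewMonoidAlgebra.induction_on (p := p) a ?_ ?_ ?_
  · have := hs 0
    rwa [map_zero] at this
  · intro g x
    exact (single_eq g x) ▸ hm _ _ (h0 x) (hof g)
  · intro a b h1 h2
    exact ha a b h1 h2

lemma algHom_ext {f g : EGAlgebra D →ₐ[ℂ] R} (h : ∀ x, f (of D x) = g (of D x))
    (h' : ∀ v, f (ι D v) = g (ι D v)) : f = g := by
  ext a
  induction a using induction with
  | hof x => exact h x
  | hι v => exact h' v
  | hs c => rw [AlgHom.commutes, AlgHom.commutes]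
  | ha a b h1 h2 => rw [map_add, map_add, h1, h2]
  | hm a b h1 h2 => rw [map_mul, map_mul, h1, h2]

variable (D)

lemma u_mul_of (g : G) : of D D.u * of D g = of D g * of D D.u := by
  rw [← map_mul, ← map_mul, D.u_central]

/-- `g ↦ g ⊗ g`. -/
def ofTensor : G →* EGAlgebra D ⊗[ℂ] EGAlgebra D where
  toFun g := of D g ⊗ₜ of D g
  map_one' := by rw [map_one, Algebra.TensorProduct.one_def]
  map_mul' g h := by rw [map_mul, Algebra.TensorProduct.tmul_mul_tmul]

/-- `v ↦ v ⊗ 1 + u ⊗ v`. -/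
def ιTensor : V →ₗ[ℂ] EGAlgebra D ⊗[ℂ] EGAlgebra D :=
  (TensorProduct.mk ℂ (EGAlgebra D) (EGAlgebra D)).flip 1 ∘ₗ ι D +
    TensorProduct.mk ℂ (EGAlgebra D) (EGAlgebra D) (of D D.u) ∘ₗ ι D

lemma ιTensor_apply (v : V) : ιTensor D v = ι D v ⊗ₜ 1 + of D D.u ⊗ₜ ι D v := rfl

/-- The untwisted comultiplication `Δ₀(g) = g ⊗ g`, `Δ₀(v) = v ⊗ 1 + u ⊗ v`: the ordinary
comultiplication obtained from the supercomultiplication of `ℂ[G ⋉ V]` (for which `v` is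
primitive) with the help of `u`. -/
def comul₀ : EGAlgebra D →ₐ[ℂ] EGAlgebra D ⊗[ℂ] EGAlgebra D :=
  lift (ofTensor D) (ιTensor D)
    (by
      intro v
      simp [ιTensor_apply, add_mul, mul_add, Algebra.TensorProduct.tmul_mul_tmul, ι_sq, u_mul_ι,
        TensorProduct.neg_tmul])
    (by
      intro g v
      simp [ofTensor, ιTensor_apply, add_mul, mul_add, Algebra.TensorProduct.tmul_mul_tmul,
        of_mul_ι, u_mul_of])

/-- The counit `ε(g) = 1`, `ε(v) = 0`. -/
def counit₀ : EGAlgebra D →ₐ[ℂ] ℂ := lift 1 0 (by simp) (by simp)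

/-- `g ↦ g⁻¹`, as a map into the opposite algebra. -/
def ofAnti : G →* (EGAlgebra D)ᵐᵒᵖ where
  toFun g := MulOpposite.op (of D g⁻¹)
  map_one' := by simp
  map_mul' g h := by rw [← MulOpposite.op_mul, ← map_mul, mul_inv_rev]

/-- `v ↦ -u v`, as a map into the opposite algebra. -/
def ιAnti : V →ₗ[ℂ] (EGAlgebra D)ᵐᵒᵖ :=
  (MulOpposite.opLinearEquiv ℂ).toLinearMap ∘ₗ
    (-(LinearMap.mulLeft ℂ (of D D.u) ∘ₗ ι D))

lemma ιAnti_apply (v : V) : ιAnti D v = MulOpposite.op (-(of D D.u * ι D v)) := rfl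

lemma ιAnti_sq (v : V) : ιAnti D v * ιAnti D v = 0 := by
  rw [ιAnti_apply, ← MulOpposite.op_mul, neg_mul_neg, mul_assoc, ← mul_assoc (ι D v),
    ← neg_neg (ι D v * of D D.u), ← u_mul_ι, neg_mul, mul_assoc, ι_sq]
  simp

lemma ofAnti_mul_ιAnti (g : G) (v : V) :
    ofAnti D g * ιAnti D v = ιAnti D (D.ρ g v) * ofAnti D g := by
  apply MulOpposite.unop_injective
  change -(of D D.u * ι D v) * of D g⁻¹ = of D g⁻¹ * -(of D D.u * ι D (D.ρ g v))
  have h : of D g⁻¹ * ι D (D.ρ g v) = ι D v * of D g⁻¹ := by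
    rw [of_mul_ι, ← Module.End.mul_apply, ← map_mul, inv_mul_cancel, map_one,
      Module.End.one_apply]
  rw [mul_neg, ← mul_assoc (of D g⁻¹), ← u_mul_of, mul_assoc (of D D.u), h, neg_mul, mul_assoc]

/-- The antipode `S(g) = g⁻¹`, `S(v) = -u v`, as an algebra map into the opposite algebra. -/
def antipodeHom : EGAlgebra D →ₐ[ℂ] (EGAlgebra D)ᵐᵒᵖ :=
  lift (ofAnti D) (ιAnti D) (ιAnti_sq D) (ofAnti_mul_ιAnti D)

lemma comul₀_of (g : G) : comul₀ D (of D g) = of D g ⊗ₜ of D g := lift_of _ _ _ _ _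
lemma comul₀_ι (v : V) : comul₀ D (ι D v) = ι D v ⊗ₜ 1 + of D D.u ⊗ₜ ι D v := lift_ι _ _ _ _ _
lemma counit₀_of (g : G) : counit₀ D (of D g) = 1 := lift_of _ _ _ _ _
lemma counit₀_ι (v : V) : counit₀ D (ι D v) = 0 := lift_ι _ _ _ _ _

lemma antipode_of (g : G) : unopMap (antipodeHom D) (of D g) = of D g⁻¹ :=
  congrArg MulOpposite.unop (lift_of (ofAnti D) (ιAnti D) (ιAnti_sq D) (ofAnti_mul_ιAnti D) g)
lemma antipode_ι (v : V) : unopMap (antipodeHom D) (ι D v) = -(of D D.u * ι D v) :=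
  congrArg MulOpposite.unop (lift_ι (ofAnti D) (ιAnti D) (ιAnti_sq D) (ofAnti_mul_ιAnti D) v)

lemma unopMap_one : unopMap (antipodeHom D) 1 = 1 := by simp [unopMap_apply]

lemma u_inv : D.u⁻¹ = D.u := inv_eq_of_mul_eq_one_left D.u_sq

lemma leftConv_comul₀ (a : EGAlgebra D) :
    leftConv (antipodeHom D) (comul₀ D a) = algebraMap ℂ _ (counit₀ D a) := by
  induction a using induction with
  | hof g =>
    rw [comul₀_of, leftConv_tmul, antipode_of, counit₀_of, ← map_mul, inv_mul_cancel]; simp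
  | hι v =>
    rw [comul₀_ι, map_add, leftConv_tmul, leftConv_tmul, antipode_of, antipode_ι, counit₀_ι, u_inv]
    simp
  | hs c =>
    rw [AlgHom.commutes, AlgHom.commutes, Algebra.TensorProduct.algebraMap_apply, leftConv_tmul,
      Algebra.algebraMap_eq_smul_one, map_smul, unopMap_one]; simp [Algebra.algebraMap_eq_smul_one]
  | ha a b h1 h2 => simp only [map_add, h1, h2]
  | hm a b h1 h2 =>
    rw [map_mul, leftConv_mul _ _ _ _ h1, h2, map_mul, map_mul, Algebra.smul_def]

lemma rightConv_comul₀ (a : EGAlgebra D) :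
    rightConv (antipodeHom D) (comul₀ D a) = algebraMap ℂ _ (counit₀ D a) := by
  induction a using induction with
  | hof g =>
    rw [comul₀_of, rightConv_tmul, antipode_of, counit₀_of, ← map_mul, mul_inv_cancel]; simp
  | hι v =>
    rw [comul₀_ι, map_add, rightConv_tmul, rightConv_tmul, unopMap_one, antipode_ι, counit₀_ι,
      mul_neg, ← mul_assoc, u_mul_u]
    simp
  | hs c =>
    rw [AlgHom.commutes, AlgHom.commutes, Algebra.TensorProduct.algebraMap_apply, rightConv_tmul,
      unopMap_one]; simp
  | ha a b h1 h2 => simp only [map_add, h1, h2]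
  | hm a b h1 h2 =>
    rw [map_mul, rightConv_mul _ _ _ _ h2, h1, map_mul, map_mul, Algebra.smul_def,
      Algebra.commutes]

/-- The map `V ⊗ V → A ⊗ A`, `v ⊗ w ↦ v u ⊗ w`. -/
def twistMap : V ⊗[ℂ] V →ₗ[ℂ] EGAlgebra D ⊗[ℂ] EGAlgebra D :=
  TensorProduct.map (LinearMap.mulRight ℂ (of D D.u) ∘ₗ ι D) (ι D)

lemma twistMap_tmul (v w : V) : twistMap D (v ⊗ₜ w) = (ι D v * of D D.u) ⊗ₜ ι D w := rfl

lemma ιu_mul_ιu (v w : V) : (ι D v * of D D.u) * (ι D w * of D D.u) = -(ι D v * ι D w) := by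
  rw [mul_assoc, ← mul_assoc (of D D.u), u_mul_ι, neg_mul, mul_assoc (ι D w), u_mul_u, mul_one,
    mul_neg]

lemma u_mul_ιu (v : V) : of D D.u * (ι D v * of D D.u) = -ι D v := by
  rw [← mul_assoc, u_mul_ι, neg_mul, mul_assoc, u_mul_u, mul_one]

lemma ιu_mul_u (v : V) : (ι D v * of D D.u) * of D D.u = ι D v := by
  rw [mul_assoc, u_mul_u, mul_one]

lemma ιu_mul_ι (v w : V) : (ι D v * of D D.u) * ι D w = ι D w * (ι D v * of D D.u) := by
  rw [mul_assoc, u_mul_ι, mul_neg, ← mul_assoc, ι_anticomm, neg_mul, neg_neg, mul_assoc]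

lemma commute_of_tmul {X : Type*} [Ring X] [Algebra ℂ X] (f g : V ⊗[ℂ] V →ₗ[ℂ] X)
    (h : ∀ v w v' w', Commute (f (v ⊗ₜ w)) (g (v' ⊗ₜ w'))) (b c : V ⊗[ℂ] V) :
    Commute (f b) (g c) := by
  induction b with
  | zero => rw [map_zero]; exact Commute.zero_left _
  | add x y hx hy => rw [map_add]; exact hx.add_left hy
  | tmul v w =>
    induction c with
    | zero => rw [map_zero]; exact Commute.zero_right _
    | add x y hx hy => rw [map_add]; exact hx.add_right hy
    | tmul v' w' => exact h v w v' w'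

lemma commute_twistMap (b c : V ⊗[ℂ] V) : Commute (twistMap D b) (twistMap D c) :=
  commute_of_tmul _ _ (by
    intro v w v' w'
    rw [Commute, SemiconjBy, twistMap_tmul, twistMap_tmul, Algebra.TensorProduct.tmul_mul_tmul,
      Algebra.TensorProduct.tmul_mul_tmul, ιu_mul_ιu, ιu_mul_ιu, ι_anticomm D v, ι_anticomm D w]
    simp [TensorProduct.neg_tmul, TensorProduct.tmul_neg]) b c

lemma isNilpotent_twistMap (b : V ⊗[ℂ] V) : IsNilpotent (twistMap D b) := by
  induction b with
  | zero => rw [map_zero]; exact IsNilpotent.zero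
  | add x y hx hy => rw [map_add]; exact (commute_twistMap D x y).isNilpotent_add hx hy
  | tmul v w =>
    refine ⟨2, ?_⟩
    rw [pow_two, twistMap_tmul, Algebra.TensorProduct.tmul_mul_tmul, ιu_mul_ιu, ι_sq]
    simp

/-- The twist: the image of `e^B` in `A ⊗ A`. -/
def J : EGAlgebra D ⊗[ℂ] EGAlgebra D := nexp (twistMap D D.B)

/-- The inverse of the twist. -/
def Jinv : EGAlgebra D ⊗[ℂ] EGAlgebra D := nexp (-twistMap D D.B)

lemma J_mul_Jinv : J D * Jinv D = 1 := nexp_mul_neg (isNilpotent_twistMap D _)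
lemma Jinv_mul_J : Jinv D * J D = 1 := nexp_neg_mul (isNilpotent_twistMap D _)

/-- The twisted comultiplication `Δ(a) = J⁻¹ Δ₀(a) J`. -/
def comulHom : EGAlgebra D →ₐ[ℂ] EGAlgebra D ⊗[ℂ] EGAlgebra D :=
  AlgHom.ofLinearMap
    (LinearMap.mulRight ℂ (J D) ∘ₗ LinearMap.mulLeft ℂ (Jinv D) ∘ₗ (comul₀ D).toLinearMap)
    (by simp [Jinv_mul_J])
    (by
      intro a b
      simp only [LinearMap.comp_apply, LinearMap.mulRight_apply, LinearMap.mulLeft_apply,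
        AlgHom.toLinearMap_apply, map_mul]
      calc _ = Jinv D * comul₀ D a * 1 * comul₀ D b * J D := by simp only [mul_assoc, one_mul]
        _ = _ := by rw [← J_mul_Jinv]; simp only [mul_assoc])

lemma comulHom_apply (a : EGAlgebra D) : comulHom D a = Jinv D * comul₀ D a * J D := rfl

section Coassoc

/-- `Δ₀ ⊗ id`. -/
def φ₁ : EGAlgebra D ⊗[ℂ] EGAlgebra D →ₐ[ℂ]
    EGAlgebra D ⊗[ℂ] (EGAlgebra D ⊗[ℂ] EGAlgebra D) :=
  (Algebra.TensorProduct.assoc ℂ ℂ ℂ (EGAlgebra D) (EGAlgebra D) (EGAlgebra D)).toAlgHom.comp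
    (Algebra.TensorProduct.map (comul₀ D) (.id ℂ (EGAlgebra D)))

/-- `x ↦ x ⊗ 1`. -/
def φ₂ : EGAlgebra D ⊗[ℂ] EGAlgebra D →ₐ[ℂ]
    EGAlgebra D ⊗[ℂ] (EGAlgebra D ⊗[ℂ] EGAlgebra D) :=
  (Algebra.TensorProduct.assoc ℂ ℂ ℂ (EGAlgebra D) (EGAlgebra D) (EGAlgebra D)).toAlgHom.comp
    Algebra.TensorProduct.includeLeft

/-- `id ⊗ Δ₀`. -/
def φ₃ : EGAlgebra D ⊗[ℂ] EGAlgebra D →ₐ[ℂ]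
    EGAlgebra D ⊗[ℂ] (EGAlgebra D ⊗[ℂ] EGAlgebra D) := Algebra.TensorProduct.map (.id ℂ (EGAlgebra D)) (comul₀ D)

/-- `x ↦ 1 ⊗ x`. -/
def φ₄ : EGAlgebra D ⊗[ℂ] EGAlgebra D →ₐ[ℂ]
    EGAlgebra D ⊗[ℂ] (EGAlgebra D ⊗[ℂ] EGAlgebra D) := Algebra.TensorProduct.includeRight

lemma φ₁_twist (v w : V) : φ₁ D (twistMap D (v ⊗ₜ w)) =
    (ι D v * of D D.u) ⊗ₜ (of D D.u ⊗ₜ ι D w) + 1 ⊗ₜ ((ι D v * of D D.u) ⊗ₜ ι D w) := by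
  rw [twistMap_tmul]
  simp [φ₁, comul₀_ι, comul₀_of, add_mul, Algebra.TensorProduct.tmul_mul_tmul, u_mul_u,
    TensorProduct.add_tmul]

lemma φ₂_twist (v w : V) : φ₂ D (twistMap D (v ⊗ₜ w)) =
    (ι D v * of D D.u) ⊗ₜ (ι D w ⊗ₜ 1) := by
  rw [twistMap_tmul]
  simp [φ₂]

lemma φ₃_twist (v w : V) : φ₃ D (twistMap D (v ⊗ₜ w)) =
    (ι D v * of D D.u) ⊗ₜ (ι D w ⊗ₜ 1) + (ι D v * of D D.u) ⊗ₜ (of D D.u ⊗ₜ ι D w) := by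
  rw [twistMap_tmul]
  simp [φ₃, comul₀_ι, TensorProduct.tmul_add]

lemma φ₄_twist (v w : V) : φ₄ D (twistMap D (v ⊗ₜ w)) =
    1 ⊗ₜ ((ι D v * of D D.u) ⊗ₜ ι D w) := rfl

lemma φ_add (b : V ⊗[ℂ] V) : φ₁ D (twistMap D b) + φ₂ D (twistMap D b) =
    φ₃ D (twistMap D b) + φ₄ D (twistMap D b) := by
  induction b with
  | zero => simp
  | add x y hx hy =>
    simp only [map_add]
    rw [add_add_add_comm, hx, hy, add_add_add_comm]
  | tmul v w => rw [φ₁_twist, φ₂_twist, φ₃_twist, φ₄_twist]; abel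

lemma φ₁₂_commute (b c : V ⊗[ℂ] V) : Commute (φ₁ D (twistMap D b)) (φ₂ D (twistMap D c)) :=
  commute_of_tmul ((φ₁ D).toLinearMap ∘ₗ twistMap D) ((φ₂ D).toLinearMap ∘ₗ twistMap D) (by
    intro v w v' w'
    simp only [LinearMap.comp_apply, AlgHom.toLinearMap_apply]
    rw [Commute, SemiconjBy, φ₁_twist, φ₂_twist, add_mul, mul_add]
    simp only [Algebra.TensorProduct.tmul_mul_tmul, ιu_mul_ιu, ιu_mul_ι, u_mul_ι, mul_one, one_mul,
      ι_anticomm D v' v, TensorProduct.neg_tmul, TensorProduct.tmul_neg, neg_neg]) b c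

lemma φ₃₄_commute (b c : V ⊗[ℂ] V) : Commute (φ₃ D (twistMap D b)) (φ₄ D (twistMap D c)) :=
  commute_of_tmul ((φ₃ D).toLinearMap ∘ₗ twistMap D) ((φ₄ D).toLinearMap ∘ₗ twistMap D) (by
    intro v w v' w'
    simp only [LinearMap.comp_apply, AlgHom.toLinearMap_apply]
    rw [Commute, SemiconjBy, φ₃_twist, φ₄_twist, add_mul, mul_add]
    simp only [Algebra.TensorProduct.tmul_mul_tmul, ιu_mul_ι, u_mul_ιu, ιu_mul_u, mul_one, one_mul,
      ι_anticomm D w' w, TensorProduct.neg_tmul, TensorProduct.tmul_neg, neg_neg]) b c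

lemma twist_eq (b : V ⊗[ℂ] V) : φ₁ D (nexp (twistMap D b)) * φ₂ D (nexp (twistMap D b)) =
    φ₃ D (nexp (twistMap D b)) * φ₄ D (nexp (twistMap D b)) := by
  have hn := isNilpotent_twistMap D b
  rw [map_nexp _ hn, map_nexp _ hn, map_nexp _ hn, map_nexp _ hn,
    ← nexp_add (φ₁₂_commute D b b) (hn.map _) (hn.map _),
    ← nexp_add (φ₃₄_commute D b b) (hn.map _) (hn.map _), φ_add]

lemma twist_eq' (b : V ⊗[ℂ] V) : φ₂ D (nexp (twistMap D b)) * φ₁ D (nexp (twistMap D b)) =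
    φ₄ D (nexp (twistMap D b)) * φ₃ D (nexp (twistMap D b)) := by
  have hn := isNilpotent_twistMap D b
  rw [map_nexp _ hn, map_nexp _ hn, map_nexp _ hn, map_nexp _ hn,
    ← nexp_add (φ₁₂_commute D b b).symm (hn.map _) (hn.map _),
    ← nexp_add (φ₃₄_commute D b b).symm (hn.map _) (hn.map _), add_comm, φ_add, add_comm]

lemma twist_J : φ₁ D (J D) * φ₂ D (J D) = φ₃ D (J D) * φ₄ D (J D) := twist_eq D D.B

lemma twist_Jinv : φ₂ D (Jinv D) * φ₁ D (Jinv D) = φ₄ D (Jinv D) * φ₃ D (Jinv D) := by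
  have h := twist_eq' D (-D.B)
  rw [map_neg] at h
  exact h

lemma coassoc₀ (a : EGAlgebra D) : φ₁ D (comul₀ D a) = φ₃ D (comul₀ D a) := by
  refine DFunLike.congr_fun (f := (φ₁ D).comp (comul₀ D)) (g := (φ₃ D).comp (comul₀ D)) ?_ a
  refine algHom_ext (fun g => ?_) (fun v => ?_)
  · simp [φ₁, φ₃, comul₀_of]
  · simp [φ₁, φ₃, comul₀_of, comul₀_ι, TensorProduct.add_tmul, TensorProduct.tmul_add,
      Algebra.TensorProduct.one_def, add_assoc]

lemma comul_left (z : EGAlgebra D ⊗[ℂ] EGAlgebra D) :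
    Algebra.TensorProduct.assoc ℂ ℂ ℂ (EGAlgebra D) (EGAlgebra D) (EGAlgebra D)
      (Algebra.TensorProduct.map (comulHom D) (.id ℂ (EGAlgebra D)) z) =
      φ₂ D (Jinv D) * φ₁ D z * φ₂ D (J D) := by
  induction z with
  | zero => simp
  | add x y hx hy => simp only [map_add, hx, hy, mul_add, add_mul]
  | tmul a b =>
    simp only [φ₁, φ₂, AlgHom.comp_apply, Algebra.TensorProduct.map_tmul, Algebra.TensorProduct.includeLeft_apply, ← map_mul,
      Algebra.TensorProduct.tmul_mul_tmul, comulHom_apply, one_mul, mul_one]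
    rfl

lemma comul_right (z : EGAlgebra D ⊗[ℂ] EGAlgebra D) :
    Algebra.TensorProduct.map (.id ℂ (EGAlgebra D)) (comulHom D) z =
      φ₄ D (Jinv D) * φ₃ D z * φ₄ D (J D) := by
  induction z with
  | zero => simp
  | add x y hx hy => simp only [map_add, hx, hy, mul_add, add_mul]
  | tmul a b =>
    simp only [φ₃, φ₄, Algebra.TensorProduct.map_tmul, Algebra.TensorProduct.includeRight_apply,
      Algebra.TensorProduct.tmul_mul_tmul, comulHom_apply, one_mul, mul_one]

lemma coassoc (a : EGAlgebra D) :
    Algebra.TensorProduct.assoc ℂ ℂ ℂ (EGAlgebra D) (EGAlgebra D) (EGAlgebra D)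
      (Algebra.TensorProduct.map (comulHom D) (.id ℂ (EGAlgebra D)) (comulHom D a)) =
      Algebra.TensorProduct.map (.id ℂ (EGAlgebra D)) (comulHom D) (comulHom D a) := by
  rw [comul_left, comul_right, comulHom_apply, map_mul, map_mul, map_mul, map_mul, coassoc₀]
  calc _ = (φ₂ D (Jinv D) * φ₁ D (Jinv D)) * φ₃ D (comul₀ D a) * (φ₁ D (J D) * φ₂ D (J D)) := by
        simp only [mul_assoc]
    _ = _ := by rw [twist_J, twist_Jinv]; simp only [mul_assoc]

end Coassoc

lemma counit_left_twist (b : V ⊗[ℂ] V) :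
    Algebra.TensorProduct.map (counit₀ D) (.id ℂ (EGAlgebra D)) (nexp (twistMap D b)) = 1 := by
  rw [map_nexp _ (isNilpotent_twistMap D b)]
  have h : Algebra.TensorProduct.map (counit₀ D) (.id ℂ (EGAlgebra D)) (twistMap D b) = 0 := by
    induction b with
    | zero => simp
    | add x y hx hy => simp only [map_add, hx, hy, add_zero]
    | tmul v w => rw [twistMap_tmul]; simp [counit₀_ι]
  rw [h, nexp_zero]

lemma counit_right_twist (b : V ⊗[ℂ] V) :
    Algebra.TensorProduct.map (.id ℂ (EGAlgebra D)) (counit₀ D) (nexp (twistMap D b)) = 1 := by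
  rw [map_nexp _ (isNilpotent_twistMap D b)]
  have h : Algebra.TensorProduct.map (.id ℂ (EGAlgebra D)) (counit₀ D) (twistMap D b) = 0 := by
    induction b with
    | zero => simp
    | add x y hx hy => simp only [map_add, hx, hy, add_zero]
    | tmul v w => rw [twistMap_tmul]; simp [counit₀_ι]
  rw [h, nexp_zero]

lemma Jinv_eq : Jinv D = nexp (twistMap D (-D.B)) := by rw [map_neg]; rfl

instance : Bialgebra ℂ (EGAlgebra D) :=
  Bialgebra.ofAlgHom (comulHom D) (counit₀ D)
    (AlgHom.ext (coassoc D))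
    (by
      have h : (Algebra.TensorProduct.map (counit₀ D) (.id ℂ (EGAlgebra D))).comp (comulHom D) =
          (Algebra.TensorProduct.map (counit₀ D) (.id ℂ (EGAlgebra D))).comp (comul₀ D) := by
        ext a
        rw [AlgHom.comp_apply, AlgHom.comp_apply, comulHom_apply, map_mul, map_mul, Jinv_eq, J,
          counit_left_twist, counit_left_twist, one_mul, mul_one]
      rw [h]
      refine algHom_ext (fun g => ?_) (fun v => ?_)
      · simp [comul₀_of, counit₀_of]
      · simp [comul₀_ι, counit₀_of, counit₀_ι])
    (by
      have h : (Algebra.TensorProduct.map (.id ℂ (EGAlgebra D)) (counit₀ D)).comp (comulHom D) =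
          (Algebra.TensorProduct.map (.id ℂ (EGAlgebra D)) (counit₀ D)).comp (comul₀ D) := by
        ext a
        rw [AlgHom.comp_apply, AlgHom.comp_apply, comulHom_apply, map_mul, map_mul, Jinv_eq, J,
          counit_right_twist, counit_right_twist, one_mul, mul_one]
      rw [h]
      refine algHom_ext (fun g => ?_) (fun v => ?_)
      · simp [comul₀_of, counit₀_of]
      · simp [comul₀_ι, counit₀_ι])

lemma comul_eq (a : EGAlgebra D) : Coalgebra.comul (R := ℂ) a = comulHom D a := rfl
lemma counit_eq (a : EGAlgebra D) : Coalgebra.counit (R := ℂ) a = counit₀ D a := rfl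

/-- `v ⊗ w ↦ v w`. -/
def prodMap : V ⊗[ℂ] V →ₗ[ℂ] EGAlgebra D :=
  LinearMap.mul' ℂ (EGAlgebra D) ∘ₗ TensorProduct.map (ι D) (ι D)

lemma prodMap_comm (b : V ⊗[ℂ] V) : prodMap D (TensorProduct.comm ℂ V V b) = -prodMap D b := by
  induction b with
  | zero => simp
  | add x y hx hy => simp only [map_add, hx, hy, neg_add]
  | tmul v w => simp [prodMap, ι_anticomm D w v]

lemma prodMap_B : prodMap D D.B = 0 := by
  have h := prodMap_comm D D.B
  rw [D.B_symm] at h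
  have h2 : (2 : ℂ) • prodMap D D.B = 0 := by
    rw [two_smul]
    nth_rewrite 2 [h]
    exact add_neg_cancel _
  exact (smul_eq_zero.mp h2).resolve_left two_ne_zero

lemma leftConv_twist (b : V ⊗[ℂ] V) (p q : EGAlgebra D) :
    leftConv (antipodeHom D) (twistMap D b * (p ⊗ₜ q)) =
      -(unopMap (antipodeHom D) p * prodMap D b * q) := by
  induction b with
  | zero => simp
  | add x y hx hy => simp only [map_add, add_mul, mul_add, hx, hy]; abel
  | tmul v w =>
    rw [twistMap_tmul, leftConv_mul_tmul, leftConv_tmul, unopMap_mul, antipode_of, antipode_ι, u_inv,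
      mul_neg, ← mul_assoc (of D D.u), u_mul_u]
    simp [prodMap, mul_assoc]

lemma rightConv_twist (b : V ⊗[ℂ] V) (p q : EGAlgebra D) :
    rightConv (antipodeHom D) ((p ⊗ₜ q) * twistMap D b) =
      -(p * prodMap D b * unopMap (antipodeHom D) q) := by
  induction b with
  | zero => simp
  | add x y hx hy => simp only [map_add, add_mul, mul_add, hx, hy]; abel
  | tmul v w =>
    have h : (ι D v * of D D.u) * (of D D.u * ι D w) = ι D v * ι D w := by
      rw [← mul_assoc, ιu_mul_u]
    rw [twistMap_tmul, rightConv_tmul_mul, rightConv_tmul, antipode_ι, mul_neg, h]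
    simp [prodMap]

lemma leftConv_twist_B (X : EGAlgebra D ⊗[ℂ] EGAlgebra D) :
    leftConv (antipodeHom D) (twistMap D D.B * X) = 0 := by
  induction X with
  | zero => simp
  | add x y hx hy => rw [mul_add, map_add, hx, hy, add_zero]
  | tmul p q => rw [leftConv_twist, prodMap_B]; simp

lemma rightConv_twist_B (X : EGAlgebra D ⊗[ℂ] EGAlgebra D) :
    rightConv (antipodeHom D) (X * twistMap D D.B) = 0 := by
  induction X with
  | zero => simp
  | add x y hx hy => rw [add_mul, map_add, hx, hy, add_zero]
  | tmul p q => rw [rightConv_twist, prodMap_B]; simp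

lemma leftConv_J (X : EGAlgebra D ⊗[ℂ] EGAlgebra D) :
    leftConv (antipodeHom D) (J D * X) = leftConv (antipodeHom D) X := by
  obtain ⟨q, hq, -⟩ := exists_nexp_eq (isNilpotent_twistMap D D.B)
  rw [J, hq, add_mul, one_mul, map_add, mul_assoc, leftConv_twist_B, add_zero]

lemma leftConv_Jinv (X : EGAlgebra D ⊗[ℂ] EGAlgebra D) :
    leftConv (antipodeHom D) (Jinv D * X) = leftConv (antipodeHom D) X := by
  rw [← leftConv_J, ← mul_assoc, J_mul_Jinv, one_mul]

lemma rightConv_J (X : EGAlgebra D ⊗[ℂ] EGAlgebra D) :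
    rightConv (antipodeHom D) (X * J D) = rightConv (antipodeHom D) X := by
  obtain ⟨q, -, hq⟩ := exists_nexp_eq (isNilpotent_twistMap D D.B)
  rw [J, hq, mul_add, mul_one, map_add, ← mul_assoc, rightConv_twist_B, add_zero]

lemma rightConv_Jinv (X : EGAlgebra D ⊗[ℂ] EGAlgebra D) :
    rightConv (antipodeHom D) (X * Jinv D) = rightConv (antipodeHom D) X := by
  rw [← rightConv_J, mul_assoc, Jinv_mul_J, mul_one]

lemma leftConv_one : leftConv (antipodeHom D) 1 = 1 := by
  rw [Algebra.TensorProduct.one_def, leftConv_tmul, unopMap_one, one_mul]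

lemma rightConv_one : rightConv (antipodeHom D) 1 = 1 := by
  rw [Algebra.TensorProduct.one_def, rightConv_tmul, unopMap_one, one_mul]

lemma leftConv_comul (a : EGAlgebra D) :
    leftConv (antipodeHom D) (comulHom D a) = algebraMap ℂ _ (counit₀ D a) := by
  rw [comulHom_apply, mul_assoc, leftConv_Jinv, leftConv_mul _ _ _ _ (leftConv_comul₀ D a),
    ← mul_one (J D), leftConv_J, leftConv_one, Algebra.algebraMap_eq_smul_one]

lemma rightConv_comul (a : EGAlgebra D) :
    rightConv (antipodeHom D) (comulHom D a) = algebraMap ℂ _ (counit₀ D a) := by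
  rw [comulHom_apply, rightConv_J, rightConv_mul _ _ _ _ (rightConv_comul₀ D a),
    ← one_mul (Jinv D), rightConv_Jinv, rightConv_one, Algebra.algebraMap_eq_smul_one]

instance : HopfAlgebra ℂ (EGAlgebra D) where
  antipode := unopMap (antipodeHom D)
  mul_antipode_rTensor_comul := LinearMap.ext (leftConv_comul D)
  mul_antipode_lTensor_comul := LinearMap.ext (rightConv_comul D)

end EGAlgebra
end EG

section Families

/-- The generating character `j ↦ e^{2πij/N}` of the cyclic group `ℤ/N`. -/
def stdChar (N : ℕ) [NeZero N] : Multiplicative (ZMod N) →* ℂ :=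
  (ZMod.stdAddChar (N := N)).toMonoidHom

/-- The representation `χ₁ ⊕ χ₂` of `G` on `ℂ²`: `g` acts on the `i`-th basis vector by `χᵢ(g)`. -/
def diagRep {G : Type*} [Group G] (χ : Fin 2 → (G →* ℂ)) : Representation ℂ G (Fin 2 → ℂ) where
  toFun g := LinearMap.pi fun i => χ i g • LinearMap.proj i
  map_one' := by ext; simp
  map_mul' g h := by ext; simp [mul_assoc]

lemma diagRep_apply {G : Type*} [Group G] (χ : Fin 2 → (G →* ℂ)) (g : G) (v : Fin 2 → ℂ)
    (i : Fin 2) : diagRep χ g v i = χ i g * v i := rfl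

/-- The tensor `∑ Mᵢⱼ eᵢ ⊗ eⱼ` with matrix `M` in the standard basis of `ℂ²`. -/
def tensorOfMatrix (M : Matrix (Fin 2) (Fin 2) ℂ) : (Fin 2 → ℂ) ⊗[ℂ] (Fin 2 → ℂ) :=
  ∑ i, ∑ j, M i j • ((Pi.single i 1 : Fin 2 → ℂ) ⊗ₜ[ℂ] (Pi.single j 1 : Fin 2 → ℂ))

lemma comm_tensorOfMatrix (M : Matrix (Fin 2) (Fin 2) ℂ) (hM : M.IsSymm) :
    TensorProduct.comm ℂ _ _ (tensorOfMatrix M) = tensorOfMatrix M := by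
  simp only [tensorOfMatrix, map_sum, map_smul, TensorProduct.comm_tmul]
  rw [Finset.sum_comm]
  simp only [hM.apply]

/-- The symmetric matrix with entries `λ₁, λ₃/2, λ₂`. -/
def lamMatrix (lam₁ lam₂ lam₃ : ℂ) : Matrix (Fin 2) (Fin 2) ℂ :=
  !![lam₁, lam₃ / 2; lam₃ / 2, lam₂]

lemma lamMatrix_isSymm (lam₁ lam₂ lam₃ : ℂ) : (lamMatrix lam₁ lam₂ lam₃).IsSymm := by
  ext i j; fin_cases i <;> fin_cases j <;> rfl

/-- The data `(G, χ₁ ⊕ χ₂, u, B)` for an abelian group `G` and a symmetric `2 × 2` matrix `B`. -/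
def diagDatum {G : Type*} [CommGroup G] (χ : Fin 2 → (G →* ℂ)) (u : G) (hu : u * u = 1)
    (hχ : ∀ i, χ i u = -1) (B : Matrix (Fin 2) (Fin 2) ℂ) (hB : B.IsSymm) :
    TwistDatum G (Fin 2 → ℂ) where
  ρ := diagRep χ
  u := u
  u_central g := mul_comm u g
  u_sq := hu
  ρ_u v := by ext i; rw [diagRep_apply, hχ]; simp
  B := tensorOfMatrix B
  B_symm := comm_tensorOfMatrix B hB

lemma stdChar_half (N : ℕ) [NeZero N] (m : ℕ) (h : N = 2 * m) :
    stdChar N (Multiplicative.ofAdd (m : ZMod N)) = -1 := by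
  have h0 : m ≠ 0 := by rintro rfl; exact NeZero.ne N h
  have h1 := ZMod.stdAddChar_coe (N := N) (m : ℤ)
  change ZMod.stdAddChar ((m : ZMod N)) = -1
  have h2 : ((m : ℤ) : ZMod N) = (m : ZMod N) := by push_cast; rfl
  rw [← h2, h1]
  have hm : (m : ℂ) ≠ 0 := Nat.cast_ne_zero.mpr h0
  have : 2 * (Real.pi : ℂ) * Complex.I * ((m : ℤ) : ℂ) / (N : ℂ) = Real.pi * Complex.I := by
    rw [h]; push_cast; field_simp
  rw [this, Complex.exp_pi_mul_I]

lemma stdChar_pow (N : ℕ) [NeZero N] (m : ℕ) :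
    stdChar N (Multiplicative.ofAdd (m : ZMod N)) = stdChar N (Multiplicative.ofAdd 1) ^ m := by
  rw [← map_pow, ← ofAdd_nsmul, nsmul_one]

/-- `G = ℤ/8 = ⟨a⟩`, `V = χ ⊕ χᵏ` with `χ(aᵐ) = e^{2πim/8}` and `k` odd, `u = a⁴`. -/
def twistZ8 (k : ℕ) (hk : Odd k) (B : Matrix (Fin 2) (Fin 2) ℂ) (hB : B.IsSymm) :
    TwistDatum (Multiplicative (ZMod 8)) (Fin 2 → ℂ) :=
  diagDatum ![stdChar 8, stdChar 8 ^ k] (Multiplicative.ofAdd 4) (by decide)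
    (by
      have h := stdChar_half 8 4 rfl
      intro i
      fin_cases i
      · exact h
      · change stdChar 8 (Multiplicative.ofAdd ((4 : ℕ) : ZMod 8)) ^ k = -1
        rw [h, hk.neg_one_pow]) B hB

/-- `G = ℤ/4 × ℤ/2 = ⟨a⟩ × ⟨b⟩`, `V = (χ, χ₊) ⊕ (χ, χ₋)` with `χ(aᵐ) = e^{2πim/4}`, `χ₊` trivial
and `χ₋` nontrivial, `u = a²`. -/
def twistZ4Z2 (B : Matrix (Fin 2) (Fin 2) ℂ) (hB : B.IsSymm) :
    TwistDatum (Multiplicative (ZMod 4) × Multiplicative (ZMod 2)) (Fin 2 → ℂ) :=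
  diagDatum
    ![(stdChar 4).comp (MonoidHom.fst _ _),
      (stdChar 4).comp (MonoidHom.fst _ _) * (stdChar 2).comp (MonoidHom.snd _ _)]
    (Multiplicative.ofAdd 2, 1) (by decide)
    (by
      have h := stdChar_half 4 2 rfl
      intro i
      fin_cases i
      · exact h
      · change stdChar 4 (Multiplicative.ofAdd ((2 : ℕ) : ZMod 4)) * stdChar 2 1 = -1
        rw [h, map_one, mul_one]) B hB

/-- `Γ = ℤ/8 = ⟨g⟩`, `g₁ = g`, `g₂ = gᵏ` with `k` odd, `χ(g) = -1`. -/
def liftingZ8 (k : ℕ) (hk : Odd k) (lam₁ lam₂ lam₃ : ℂ) :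
    LiftingDatum (Multiplicative (ZMod 8)) where
  g := ![Multiplicative.ofAdd 1, Multiplicative.ofAdd (k : ZMod 8)]
  χ := stdChar 8 ^ 4
  χ_g i := by
    have h := stdChar_half 8 4 rfl
    rw [stdChar_pow] at h
    fin_cases i
    · exact h
    · change stdChar 8 (Multiplicative.ofAdd (k : ZMod 8)) ^ 4 = -1
      rw [stdChar_pow, pow_right_comm, h, hk.neg_one_pow]
  lam₁ := lam₁
  lam₂ := lam₂
  lam₃ := lam₃

/-- `Γ = ℤ/4 × ℤ/2 = ⟨g⟩ × ⟨h⟩`, `g₁ = g`, `g₂ = g h`, `χ(g) = -1`, `χ(h) = 1`. -/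
def liftingZ4Z2 (lam₁ lam₂ lam₃ : ℂ) :
    LiftingDatum (Multiplicative (ZMod 4) × Multiplicative (ZMod 2)) where
  g := ![(Multiplicative.ofAdd 1, 1), (Multiplicative.ofAdd 1, Multiplicative.ofAdd 1)]
  χ := (stdChar 4 ^ 2).comp (MonoidHom.fst _ _)
  χ_g i := by
    have h := stdChar_half 4 2 rfl
    rw [stdChar_pow] at h
    fin_cases i <;> exact h
  lam₁ := lam₁
  lam₂ := lam₂
  lam₃ := lam₃

end Families

end EtingofGelaki
end

/-! The isomorphism is written down on generators. A character of `G`, extended by zero on `V`, is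
an algebra map `A → ℂ`, hence a group-like element of `A*`; this is where `Γ` goes, through an
identification `θ` of `Γ` with the characters of `G`. A linear form `ξ` on `V` on which `G` acts by
`ψ` gives the triangular representation `g ↦ diag(ψ(g), 1)`, `v ↦ ξ(v) E₁₂`; its upper right matrix
coefficient is skew-primitive in `A*`, and this is where `xᵢ` goes (`comul_skewElt`).

The twist enters only in products of two skew-primitive elements. Under two triangular
representations `J` becomes `1 + c E₁₂ ⊗ E₁₂` with `c = (ξ ⊗ ξ')(B)`, and conjugating `Δ₀(g)` by it
produces the value `c (ψψ'(g) - 1)`. Since a skew-primitive element of `A*` is determined by its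
values on `G` and `V` (`ext_of_comul_eq`), this value gives the full relation between the `xᵢ`
(`skewElt_anticomm`). Scaling the coordinate forms by `i` turns the sign into the one in the
presentation of `H`.

Bijectivity is a dimension count. The monomials `γ`, `x₁γ`, `x₂γ`, `x₁x₂γ` span `H`, and their
images in `A*` are independent by evaluation on `g e₁ e₂`, `g e₂`, `g e₁`, `g` and independence of
characters (`linearIndependent_dual`). So `dim H = 4|Γ|` and the map is injective, while the
corresponding monomials spanning `A` give `dim A ≤ 4|G| = 4|Γ|`. A bialgebra isomorphism of Hopf
algebras respects antipodes automatically.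

The same basis yields pointedness and the group-likes: slicing the right tensor leg of `Δ(d)` at a
leading coefficient of `d` extracts an element of `Γ` from any nonzero subcoalgebra
(`exists_of_mem`). All of this is done once for an abstract dual pair; the three families only
supply `θ`. -/

open scoped TensorProduct
noncomputable section
namespace EtingofGelaki

/-! ### Normal forms: spanning by ordered monomials -/

section Spanning
variable {Γ R : Type*} [Group Γ] [Ring R] [Algebra ℂ R]

/-- The elements `γ`, `y₀ γ`, `y₁ γ`, `y₀ y₁ γ`. -/
def normalMonomial (f : Γ →* R) (y : Fin 2 → R) (p : Γ × Fin 4) : R :=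
  ![1, y 0, y 1, y 0 * y 1] p.2 * f p.1

variable (f : Γ →* R) (y : Fin 2 → R)

lemma map_normalMonomial {S : Type*} [Ring S] [Algebra ℂ S] (φ : R →ₐ[ℂ] S) (p : Γ × Fin 4) :
    φ (normalMonomial f y p) =
      normalMonomial ((φ : R →* S).comp f) (fun i => φ (y i)) p := by
  obtain ⟨γ, m⟩ := p
  fin_cases m <;> simp [normalMonomial]

variable {f y} {c : Γ → Fin 2 → ℂ}

/-- Group elements move to the right at the cost of a scalar, squares of the `y i` reduce to group
elements, and `y 1 * y 0` is reordered through the anticommutator. Stating this for any such `f` and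
`y` serves both the lifting and `ℂ[G] ⋉ ΛV`. -/
lemma mul_mem_span_normalMonomial (hc : ∀ γ i, f γ * y i = c γ i • (y i * f γ))
    (h₀ : y 0 * y 0 ∈ Submodule.span ℂ (Set.range f))
    (h₁ : y 1 * y 1 ∈ Submodule.span ℂ (Set.range f))
    (h₂ : y 0 * y 1 + y 1 * y 0 ∈ Submodule.span ℂ (Set.range f)) :
    (∀ γ, ∀ w ∈ Submodule.span ℂ (Set.range (normalMonomial f y)),
      f γ * w ∈ Submodule.span ℂ (Set.range (normalMonomial f y))) ∧
    (∀ i, ∀ w ∈ Submodule.span ℂ (Set.range (normalMonomial f y)),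
      y i * w ∈ Submodule.span ℂ (Set.range (normalMonomial f y))) := by
  set W := Submodule.span ℂ (Set.range (normalMonomial f y)) with hW
  set S := Submodule.span ℂ (Set.range f) with hS
  have m0 : ∀ γ, f γ ∈ W := fun γ =>
    Submodule.subset_span ⟨(γ, 0), by simp [normalMonomial]⟩
  have m1 : ∀ i γ, y i * f γ ∈ W := fun i γ => by
    fin_cases i
    · exact Submodule.subset_span ⟨(γ, 1), by simp [normalMonomial]⟩
    · exact Submodule.subset_span ⟨(γ, 2), by simp [normalMonomial]⟩
  have m2 : ∀ γ, y 0 * (y 1 * f γ) ∈ W := fun γ =>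
    Submodule.subset_span ⟨(γ, 3), by simp [normalMonomial, mul_assoc]⟩
  -- Stability of `W` under left multiplication need only be checked on the monomials of degree 0, 1
  -- and 2 in the `y i`.
  have ext (a : R) (k0 : ∀ γ, a * f γ ∈ W) (k1 : ∀ i γ, a * (y i * f γ) ∈ W)
      (k2 : ∀ γ, a * (y 0 * (y 1 * f γ)) ∈ W) : ∀ w ∈ W, a * w ∈ W := by
    intro w hw
    induction hw using Submodule.span_induction with
    | mem w hw =>
      obtain ⟨⟨γ, m⟩, rfl⟩ := hw
      fin_cases m
      · simpa [normalMonomial] using k0 γ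
      · simpa [normalMonomial] using k1 0 γ
      · simpa [normalMonomial] using k1 1 γ
      · simpa [normalMonomial, mul_assoc] using k2 γ
    | zero => simp
    | add v w _ _ hv hw => rw [mul_add]; exact W.add_mem hv hw
    | smul r w _ hw => rw [mul_smul_comm]; exact W.smul_mem r hw
  have hc' : ∀ γ i z, f γ * (y i * z) = c γ i • (y i * (f γ * z)) := fun γ i z => by
    rw [← mul_assoc, hc, smul_mul_assoc, mul_assoc]
  have hf : ∀ γ, ∀ w ∈ W, f γ * w ∈ W := fun γ => by
    refine ext _ (fun δ => ?_) (fun i δ => ?_) (fun δ => ?_)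
    · rw [← map_mul]; exact m0 _
    · rw [hc', ← map_mul]; exact W.smul_mem _ (m1 _ _)
    · rw [hc', hc', mul_smul_comm, ← map_mul]
      exact W.smul_mem _ (W.smul_mem _ (m2 _))
  have hSW : ∀ q ∈ S, ∀ w ∈ W, q * w ∈ W := fun q hq w hw => by
    induction hq using Submodule.span_induction with
    | mem q hq => obtain ⟨γ, rfl⟩ := hq; exact hf γ w hw
    | zero => simp
    | add p q _ _ hp hq => rw [add_mul]; exact W.add_mem hp hq
    | smul r q _ hq => rw [smul_mul_assoc]; exact W.smul_mem r hq
  -- Needed for `y 1 * (y 0 * y 1 * f γ)`: reordering leaves `y 0 * (y 1 * y 1) * f γ`, where the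
  -- square is a combination of group elements standing to the right of `y 0`.
  have hSS : ∀ q ∈ S, ∀ γ, y 0 * (q * f γ) ∈ W := fun q hq γ => by
    induction hq using Submodule.span_induction with
    | mem q hq => obtain ⟨δ, rfl⟩ := hq; rw [← map_mul]; exact m1 0 _
    | zero => simp
    | add p q _ _ hp hq => rw [add_mul, mul_add]; exact W.add_mem hp hq
    | smul r q _ hq => rw [smul_mul_assoc, mul_smul_comm]; exact W.smul_mem r hq
  have hy0 : ∀ w ∈ W, y 0 * w ∈ W := by
    refine ext _ (m1 0) (fun i γ => ?_) (fun γ => ?_)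
    · fin_cases i
      · change y 0 * (y 0 * f γ) ∈ W
        rw [← mul_assoc]; exact hSW _ h₀ _ (m0 γ)
      · exact m2 γ
    · rw [← mul_assoc]; exact hSW _ h₀ _ (m1 1 γ)
  have hswap : ∀ z, y 1 * (y 0 * z) = (y 0 * y 1 + y 1 * y 0) * z - y 0 * (y 1 * z) := fun z => by
    noncomm_ring
  have hy1 : ∀ w ∈ W, y 1 * w ∈ W := by
    refine ext _ (m1 1) (fun i γ => ?_) (fun γ => ?_)
    · fin_cases i
      · change y 1 * (y 0 * f γ) ∈ W
        rw [hswap]; exact W.sub_mem (hSW _ h₂ _ (m0 γ)) (m2 γ)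
      · change y 1 * (y 1 * f γ) ∈ W
        rw [← mul_assoc]; exact hSW _ h₁ _ (m0 γ)
    · rw [hswap, ← mul_assoc (y 1) (y 1)]
      exact W.sub_mem (hSW _ h₂ _ (m1 1 γ)) (hSS _ h₁ γ)
  exact ⟨hf, fun i => by fin_cases i; exacts [hy0, hy1]⟩

/-- If `1` and multiplication by the generators suffice to reach everything, the normal monomials
span. -/
lemma span_normalMonomial_eq_top (hc : ∀ γ i, f γ * y i = c γ i • (y i * f γ))
    (h₀ : y 0 * y 0 ∈ Submodule.span ℂ (Set.range f))
    (h₁ : y 1 * y 1 ∈ Submodule.span ℂ (Set.range f))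
    (h₂ : y 0 * y 1 + y 1 * y 0 ∈ Submodule.span ℂ (Set.range f))
    (hgen : ∀ W : Submodule ℂ R, (∀ γ, ∀ w ∈ W, f γ * w ∈ W) → (∀ i, ∀ w ∈ W, y i * w ∈ W) →
      ∀ a, ∀ w ∈ W, a * w ∈ W) :
    Submodule.span ℂ (Set.range (normalMonomial f y)) = ⊤ := by
  obtain ⟨hf, hy⟩ := mul_mem_span_normalMonomial hc h₀ h₁ h₂
  refine Submodule.eq_top_iff'.mpr fun a => ?_
  have h1 : (1 : R) ∈ Submodule.span ℂ (Set.range (normalMonomial f y)) :=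
    Submodule.subset_span ⟨(1, 0), by simp [normalMonomial]⟩
  simpa using hgen _ hf hy a 1 h1

end Spanning

/-! ### Spanning sets of the lifting and of `ℂ[G] ⋉ ΛV` -/

namespace Lifting
variable {Γ : Type*} [CommGroup Γ] (D : LiftingDatum Γ)

lemma span_normalMonomial : Submodule.span ℂ (Set.range (normalMonomial (of D) (x D))) = ⊤ := by
  have key (c : ℂ) (γ δ : Γ) :
      c • (1 - of D γ * of D δ) ∈ Submodule.span ℂ (Set.range (of D)) := by
    rw [← map_mul, ← map_one (of D)]
    exact Submodule.smul_mem _ _ (Submodule.sub_mem _ (Submodule.subset_span ⟨_, rfl⟩)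
      (Submodule.subset_span ⟨_, rfl⟩))
  refine span_normalMonomial_eq_top (c := fun γ _ => D.χ γ) (of_mul_x D) ?_ ?_ ?_ ?_
  · rw [x_sq₁]; exact key _ _ _
  · rw [x_sq₂]; exact key _ _ _
  · rw [x_link]; exact key _ _ _
  · intro W hf hy a
    induction a using induction with
    | hof γ => exact hf γ
    | hx i => exact hy i
    | hs c => intro w hw; rw [← Algebra.smul_def]; exact W.smul_mem c hw
    | ha a b h1 h2 => intro w hw; rw [add_mul]; exact W.add_mem (h1 w hw) (h2 w hw)
    | hm a b h1 h2 => intro w hw; rw [mul_assoc]; exact h1 _ (h2 w hw)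

end Lifting

namespace EGAlgebra
variable {G : Type*} [Group G] (D : TwistDatum G (Fin 2 → ℂ))

/-- The images of the standard basis vectors of `V = ℂ²`. -/
def e (i : Fin 2) : EGAlgebra D := ι D (Pi.single i 1)

lemma ι_eq_sum (v : Fin 2 → ℂ) : ι D v = v 0 • e D 0 + v 1 • e D 1 := by
  rw [e, e, ← map_smul, ← map_smul, ← map_add]
  congr 1
  ext i; fin_cases i <;> simp

/-- Because `G` acts diagonally, group elements commute with the `e i` up to a scalar, and the
exterior relations are the case of the rewriting rules with zero right-hand sides. -/
lemma span_normalMonomial {χ : Fin 2 → (G →* ℂ)} (hχ : D.ρ = diagRep χ) :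
    Submodule.span ℂ (Set.range (normalMonomial (of D) (e D))) = ⊤ := by
  refine span_normalMonomial_eq_top (c := fun g i => χ i g) (fun g i => ?_) ?_ ?_ ?_ ?_
  · rw [e, of_mul_ι, ← smul_mul_assoc, ← map_smul]
    congr 2
    ext j
    rw [hχ, diagRep_apply]
    by_cases h : j = i
    · subst h; simp
    · simp [h]
  · rw [e, ι_sq]; exact Submodule.zero_mem _
  · rw [e, ι_sq]; exact Submodule.zero_mem _
  · rw [e, e, ι_anticomm, neg_add_cancel]; exact Submodule.zero_mem _
  · intro W hf hy a
    induction a using induction with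
    | hof γ => exact hf γ
    | hι v =>
      intro w hw
      rw [ι_eq_sum, add_mul, smul_mul_assoc, smul_mul_assoc]
      exact W.add_mem (W.smul_mem _ (hy 0 w hw)) (W.smul_mem _ (hy 1 w hw))
    | hs c => intro w hw; rw [← Algebra.smul_def]; exact W.smul_mem c hw
    | ha a b h1 h2 => intro w hw; rw [add_mul]; exact W.add_mem (h1 w hw) (h2 w hw)
    | hm a b h1 h2 => intro w hw; rw [mul_assoc]; exact h1 _ (h2 w hw)

/-- An upper bound is enough: the reverse inequality comes from the injection of the lifting into
the dual, so the dimension of the exterior algebra is never computed. -/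
lemma finrank_le [Fintype G] {χ : Fin 2 → (G →* ℂ)} (hχ : D.ρ = diagRep χ) :
    Module.finrank ℂ (EGAlgebra D) ≤ Fintype.card (G × Fin 4) := by
  have h := finrank_range_le_card (R := ℂ) (normalMonomial (of D) (e D))
  rwa [Set.finrank, span_normalMonomial D hχ, finrank_top] at h

end EGAlgebra

/-! ### Group-likes and matrix coefficients in the dual Hopf algebra -/

namespace HopfDual
variable {A : Type*} [Ring A] [HopfAlgebra ℂ A] [Module.Finite ℂ A]

lemma toDual_apply_mul (f : HopfDual ℂ A) (a b : A) :
    toDual ℂ A f (a * b) = pairing ℂ A (Coalgebra.comul f) (a ⊗ₜ b) := by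
  rw [comul_eq, pairing_comulMap, LinearMap.mul'_apply]

/-- An algebra map to the base field, as an element of the dual. -/
def ofAlgHom (φ : A →ₐ[ℂ] ℂ) : HopfDual ℂ A := (toDual ℂ A).symm φ.toLinearMap

omit [Module.Finite ℂ A] in
lemma toDual_ofAlgHom (φ : A →ₐ[ℂ] ℂ) (a : A) : toDual ℂ A (ofAlgHom φ) a = φ a := rfl

lemma comul_ofAlgHom (φ : A →ₐ[ℂ] ℂ) :
    Coalgebra.comul (R := ℂ) (ofAlgHom φ) = ofAlgHom φ ⊗ₜ ofAlgHom φ := by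
  refine ext_tensor fun a b => ?_
  rw [← toDual_apply_mul, pairing_tmul]
  simp only [toDual_ofAlgHom, map_mul]

/-- Functionals that factor through algebra maps `X` and `Y` see a tensor only through its image in
`R ⊗ S`; this moves convolution products into small matrix algebras. -/
lemma pairing_comp {R S : Type*} [Ring R] [Algebra ℂ R] [Ring S] [Algebra ℂ S]
    (X : A →ₐ[ℂ] R) (Y : A →ₐ[ℂ] S) (φ : R →ₗ[ℂ] ℂ) (ψ : S →ₗ[ℂ] ℂ) (z : A ⊗[ℂ] A) :
    pairing ℂ A ((toDual ℂ A).symm (φ ∘ₗ X.toLinearMap) ⊗ₜ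
      (toDual ℂ A).symm (ψ ∘ₗ Y.toLinearMap)) z =
    LinearMap.mul' ℂ ℂ (TensorProduct.map φ ψ (Algebra.TensorProduct.map X Y z)) := by
  induction z with
  | zero => simp
  | add x y hx hy => simp only [map_add, hx, hy]
  | tmul a b => simp [pairing_tmul]

end HopfDual

namespace EGAlgebra
open HopfDual
variable {G V : Type*} [Group G] [AddCommGroup V] [Module ℂ V] (D : TwistDatum G V)

/-! ### Convolution of functionals factoring through algebra maps -/

section Convolution
variable {R S : Type*} [Ring R] [Algebra ℂ R] [Ring S] [Algebra ℂ S]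
  (X : EGAlgebra D →ₐ[ℂ] R) (Y : EGAlgebra D →ₐ[ℂ] S)

/-- The image of the comultiplication under a pair of algebra maps. -/
lemma map_comulHom (a : EGAlgebra D) :
    Algebra.TensorProduct.map X Y (comulHom D a) =
      nexp (-Algebra.TensorProduct.map X Y (twistMap D D.B)) *
        Algebra.TensorProduct.map X Y (comul₀ D a) *
        nexp (Algebra.TensorProduct.map X Y (twistMap D D.B)) := by
  have hn := isNilpotent_twistMap D D.B
  rw [comulHom_apply, map_mul, map_mul, Jinv, J, map_nexp _ hn, map_nexp _ hn.neg, map_neg]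

/-- Each leg of `v u ⊗ w` contains a vector of `V`, so killing `V` in one leg kills the twist. Hence
products with a character can be computed with `Δ₀`. -/
lemma map_twistMap_eq_zero_left (hX : ∀ v, X (ι D v) = 0) (b : V ⊗[ℂ] V) :
    Algebra.TensorProduct.map X Y (twistMap D b) = 0 := by
  induction b with
  | zero => simp
  | add x y hx hy => simp only [map_add, hx, hy, add_zero]
  | tmul v w => rw [twistMap_tmul]; simp [hX]

lemma map_twistMap_eq_zero_right (hY : ∀ v, Y (ι D v) = 0) (b : V ⊗[ℂ] V) :
    Algebra.TensorProduct.map X Y (twistMap D b) = 0 := by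
  induction b with
  | zero => simp
  | add x y hx hy => simp only [map_add, hx, hy, add_zero]
  | tmul v w => rw [twistMap_tmul]; simp [hY]

variable {X Y}

lemma map_comulHom_of_left (hX : ∀ v, X (ι D v) = 0) (a : EGAlgebra D) :
    Algebra.TensorProduct.map X Y (comulHom D a) =
      Algebra.TensorProduct.map X Y (comul₀ D a) := by
  rw [map_comulHom, map_twistMap_eq_zero_left D X Y hX, neg_zero, nexp_zero, one_mul, mul_one]

lemma map_comulHom_of_right (hY : ∀ v, Y (ι D v) = 0) (a : EGAlgebra D) :
    Algebra.TensorProduct.map X Y (comulHom D a) =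
      Algebra.TensorProduct.map X Y (comul₀ D a) := by
  rw [map_comulHom, map_twistMap_eq_zero_right D X Y hY, neg_zero, nexp_zero, one_mul, mul_one]

variable [Finite G] [FiniteDimensional ℂ V]

lemma toDual_mul_comp (φ : R →ₗ[ℂ] ℂ) (ψ : S →ₗ[ℂ] ℂ) (a : EGAlgebra D) :
    toDual ℂ _ ((toDual ℂ (EGAlgebra D)).symm (φ ∘ₗ X.toLinearMap) *
      (toDual ℂ (EGAlgebra D)).symm (ψ ∘ₗ Y.toLinearMap)) a =
    LinearMap.mul' ℂ ℂ (TensorProduct.map φ ψ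
      (Algebra.TensorProduct.map X Y (comulHom D a))) := by
  rw [toDual_mul', pairing_comp]; rfl

end Convolution

/-! ### Characters and triangular representations of the twisted algebra -/

/-- The algebra map `A → ℂ` extending a character of `G` by zero on `V`. -/
def charHom (ψ : G →* ℂ) : EGAlgebra D →ₐ[ℂ] ℂ := lift ψ 0 (by simp) (by simp)

lemma charHom_of (ψ : G →* ℂ) (g : G) : charHom D ψ (of D g) = ψ g := lift_of _ _ _ _ _

lemma charHom_ι (ψ : G →* ℂ) (v : V) : charHom D ψ (ι D v) = 0 := lift_ι _ _ _ _ _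

variable {D} in
/-- A semi-invariant linear form on `V`, with the character by which `G` acts on it. -/
structure SemiInvariant (ψ : G →* ℂ) (ξ : V →ₗ[ℂ] ℂ) : Prop where
  map_rho : ∀ g v, ξ (D.ρ g v) = ψ g * ξ v

variable {D} {ψ : G →* ℂ} {ξ : V →ₗ[ℂ] ℂ}

/-- The triangular representation `g ↦ diag(ψ(g), 1)`, `v ↦ ξ(v) E₁₂`. -/
def triHom (h : SemiInvariant (D := D) ψ ξ) : EGAlgebra D →ₐ[ℂ] Matrix (Fin 2) (Fin 2) ℂ :=
  lift
    { toFun := fun g => !![ψ g, 0; 0, 1]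
      map_one' := by simp [Matrix.one_fin_two]
      map_mul' := fun g g' => by simp }
    (ξ.smulRight (!![0, 1; 0, 0] : Matrix (Fin 2) (Fin 2) ℂ))
    (fun v => by ext i j; fin_cases i <;> fin_cases j <;> simp [Matrix.mul_apply])
    -- Left multiplication by `diag(ψ(g), 1)` scales `E₁₂` by `ψ(g)` and right multiplication fixes
    -- it, so the crossed relation amounts to semi-invariance of `ξ`.
    (fun g v => by simp [h.map_rho, mul_comm])

variable (h : SemiInvariant (D := D) ψ ξ)

lemma triHom_of (g : G) : triHom h (of D g) = !![ψ g, 0; 0, 1] := lift_of _ _ _ _ _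

lemma triHom_ι (v : V) : triHom h (ι D v) = ξ v • !![0, 1; 0, 0] := lift_ι _ _ _ _ _

lemma triHom_one_zero (a : EGAlgebra D) : triHom h a 1 0 = 0 := by
  induction a using induction with
  | hof g => rw [triHom_of]; simp
  | hι v => rw [triHom_ι]; simp
  | hs c => rw [AlgHom.commutes]; simp [Matrix.algebraMap_matrix_apply]
  | ha a b h1 h2 => rw [map_add, Matrix.add_apply, h1, h2, add_zero]
  | hm a b h1 h2 => rw [map_mul, Matrix.mul_apply, Fin.sum_univ_two, h1, h2]; simp

/-- On upper triangular matrices the diagonal entries are multiplicative, so they are algebra maps,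
determined by their values on `G` and `V`. -/
lemma triHom_zero_zero (a : EGAlgebra D) : triHom h a 0 0 = charHom D ψ a := by
  induction a using induction with
  | hof g => rw [triHom_of, charHom_of]; simp
  | hι v => rw [triHom_ι, charHom_ι]; simp
  | hs c => rw [AlgHom.commutes, AlgHom.commutes]; simp [Matrix.algebraMap_matrix_apply]
  | ha a b h1 h2 => rw [map_add, map_add, Matrix.add_apply, h1, h2]
  | hm a b h1 h2 =>
    rw [map_mul, map_mul, Matrix.mul_apply, Fin.sum_univ_two, triHom_one_zero, h1, h2]; simp

lemma triHom_one_one (a : EGAlgebra D) : triHom h a 1 1 = counit₀ D a := by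
  induction a using induction with
  | hof g => rw [triHom_of, counit₀_of]; simp
  | hι v => rw [triHom_ι, counit₀_ι]; simp
  | hs c => rw [AlgHom.commutes, AlgHom.commutes]; simp [Matrix.algebraMap_matrix_apply]
  | ha a b h1 h2 => rw [map_add, map_add, Matrix.add_apply, h1, h2]
  | hm a b h1 h2 =>
    rw [map_mul, map_mul, Matrix.mul_apply, Fin.sum_univ_two, triHom_one_zero, h1, h2]; simp

/-- The upper right entry of a `2 × 2` matrix. -/
def upperEntry : Matrix (Fin 2) (Fin 2) ℂ →ₗ[ℂ] ℂ := Matrix.entryLinearMap ℂ ℂ 0 1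

lemma upperEntry_apply (M : Matrix (Fin 2) (Fin 2) ℂ) : upperEntry M = M 0 1 := rfl

/-! ### Group-like and skew-primitive elements of the dual, and their commutation -/

section Dual
variable [Finite G] [FiniteDimensional ℂ V]

variable (D) in
/-- The group-like element of the dual given by a character of `G`. -/
def charElt : (G →* ℂ) →* HopfDual ℂ (EGAlgebra D) where
  toFun ψ := ofAlgHom (charHom D ψ)
  map_one' := by
    apply (toDual ℂ (EGAlgebra D)).injective
    ext a
    rw [toDual_ofAlgHom, HopfDual.toDual_one, EGAlgebra.counit_eq]
    rfl
  map_mul' ψ ψ' := by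
    apply (toDual ℂ (EGAlgebra D)).injective
    ext a
    rw [toDual_ofAlgHom]
    have key := toDual_mul_comp D (X := charHom D ψ) (Y := charHom D ψ') .id .id a
    refine Eq.trans ?_ key.symm
    -- The convolution of two characters is the composite of algebra maps `A → A ⊗ A → ℂ`, so it can
    -- be compared with the pointwise product on generators.
    have h2 : charHom D (ψ * ψ') = ((Algebra.TensorProduct.lmul' ℂ).comp
        (Algebra.TensorProduct.map (charHom D ψ) (charHom D ψ'))).comp (comulHom D) := by
      refine algHom_ext (fun g => ?_) (fun v => ?_)
      · rw [AlgHom.comp_apply, AlgHom.comp_apply, map_comulHom_of_left D (charHom_ι D ψ), comul₀_of]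
        simp [charHom_of]
      · rw [AlgHom.comp_apply, AlgHom.comp_apply, map_comulHom_of_left D (charHom_ι D ψ), comul₀_ι]
        simp [charHom_ι]
    rw [h2, TensorProduct.map_id]
    rfl

lemma toDual_charElt (ψ : G →* ℂ) (a : EGAlgebra D) :
    toDual ℂ _ (charElt D ψ) a = charHom D ψ a := rfl

lemma comul_charElt (ψ : G →* ℂ) :
    Coalgebra.comul (R := ℂ) (charElt D ψ) = charElt D ψ ⊗ₜ charElt D ψ := comul_ofAlgHom _

/-- The skew-primitive element of the dual given by a semi-invariant linear form. -/
def skewElt : HopfDual ℂ (EGAlgebra D) :=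
  (toDual ℂ (EGAlgebra D)).symm (upperEntry ∘ₗ (triHom h).toLinearMap)

omit [Finite G] [FiniteDimensional ℂ V] in
lemma toDual_skewElt (a : EGAlgebra D) : toDual ℂ _ (skewElt h) a = triHom h a 0 1 := rfl

omit [Finite G] [FiniteDimensional ℂ V] in
lemma toDual_skewElt_of (g : G) : toDual ℂ _ (skewElt h) (of D g) = 0 := by
  rw [toDual_skewElt, triHom_of]; simp

/-- Matrix coefficients comultiply by the matrix product, and triangularity leaves two terms, whose
diagonal entries are the character `ψ` and the counit. -/
lemma comul_skewElt :
    Coalgebra.comul (R := ℂ) (skewElt h) = skewElt h ⊗ₜ 1 + charElt D ψ ⊗ₜ skewElt h := by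
  refine ext_tensor fun a b => ?_
  rw [← toDual_apply_mul, map_add, LinearMap.add_apply, pairing_tmul, pairing_tmul,
    HopfDual.toDual_one, EGAlgebra.counit_eq, toDual_charElt, toDual_skewElt, toDual_skewElt, toDual_skewElt, map_mul,
    Matrix.mul_apply, Fin.sum_univ_two, triHom_zero_zero, triHom_one_one, add_comm]

/-- The comultiplication of `f` expresses `f (a * b)` through `f a`, `f b` and the common `p`, `q`,
so agreement on generators propagates to products. Relations in the dual thereby reduce to
evaluation on `G` and `V`. -/
lemma ext_of_comul_eq {f f' p q : HopfDual ℂ (EGAlgebra D)}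
    (hf : Coalgebra.comul (R := ℂ) f = f ⊗ₜ p + q ⊗ₜ f)
    (hf' : Coalgebra.comul (R := ℂ) f' = f' ⊗ₜ p + q ⊗ₜ f')
    (hof : ∀ g, toDual ℂ _ f (of D g) = toDual ℂ _ f' (of D g))
    (hι : ∀ v, toDual ℂ _ f (ι D v) = toDual ℂ _ f' (ι D v)) : f = f' := by
  apply (toDual ℂ (EGAlgebra D)).injective
  ext a
  induction a using induction with
  | hof g => exact hof g
  | hι v => exact hι v
  | hs c =>
    rw [Algebra.algebraMap_eq_smul_one, map_smul, map_smul, ← map_one (of D), hof]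
  | ha a b h1 h2 => rw [map_add, map_add, h1, h2]
  | hm a b h1 h2 =>
    rw [toDual_apply_mul, toDual_apply_mul, hf, hf', map_add, map_add, LinearMap.add_apply,
      LinearMap.add_apply, pairing_tmul, pairing_tmul, pairing_tmul, pairing_tmul, h1, h2]

lemma toDual_charElt_mul_skewElt_of (φ : G →* ℂ) (g : G) :
    toDual ℂ _ (charElt D φ * skewElt h) (of D g) = 0 := by
  have key := toDual_mul_comp D (X := charHom D φ) (Y := triHom h) .id upperEntry (of D g)
  refine key.trans ?_
  rw [map_comulHom_of_left D (charHom_ι D φ), comul₀_of]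
  simp [triHom_of, upperEntry_apply]

lemma toDual_charElt_mul_skewElt_ι (φ : G →* ℂ) (v : V) :
    toDual ℂ _ (charElt D φ * skewElt h) (ι D v) = φ D.u * ξ v := by
  have key := toDual_mul_comp D (X := charHom D φ) (Y := triHom h) .id upperEntry (ι D v)
  refine key.trans ?_
  rw [map_comulHom_of_left D (charHom_ι D φ), comul₀_ι]
  simp [triHom_ι, upperEntry_apply, charHom_ι, charHom_of]

lemma toDual_skewElt_mul_charElt_of (φ : G →* ℂ) (g : G) :
    toDual ℂ _ (skewElt h * charElt D φ) (of D g) = 0 := by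
  have key := toDual_mul_comp D (X := triHom h) (Y := charHom D φ) upperEntry .id (of D g)
  refine key.trans ?_
  rw [map_comulHom_of_right D (charHom_ι D φ), comul₀_of]
  simp [triHom_of, upperEntry_apply]

lemma toDual_skewElt_mul_charElt_ι (φ : G →* ℂ) (v : V) :
    toDual ℂ _ (skewElt h * charElt D φ) (ι D v) = ξ v := by
  have key := toDual_mul_comp D (X := triHom h) (Y := charHom D φ) upperEntry .id (ι D v)
  refine key.trans ?_
  rw [map_comulHom_of_right D (charHom_ι D φ), comul₀_ι]
  simp [triHom_ι, upperEntry_apply, charHom_ι]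

/-- On `v`, one order of the product sees the term `u ⊗ v` of `Δ₀(v)` and the other the term `v ⊗
1`; the scalar `φ D.u` is the only difference. -/
lemma charElt_mul_skewElt (φ : G →* ℂ) :
    charElt D φ * skewElt h = φ D.u • (skewElt h * charElt D φ) := by
  have hc : charElt D ψ * charElt D φ = charElt D φ * charElt D ψ := by
    rw [← map_mul, ← map_mul, mul_comm]
  refine ext_of_comul_eq (p := charElt D φ) (q := charElt D φ * charElt D ψ) ?_ ?_
    (fun g => ?_) (fun v => ?_)
  · rw [Bialgebra.comul_mul, comul_charElt, comul_skewElt]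
    simp [mul_add, Algebra.TensorProduct.tmul_mul_tmul]
  · rw [map_smul, Bialgebra.comul_mul, comul_charElt, comul_skewElt]
    simp [add_mul, Algebra.TensorProduct.tmul_mul_tmul, hc, TensorProduct.smul_tmul']
  · rw [map_smul, LinearMap.smul_apply, toDual_charElt_mul_skewElt_of,
      toDual_skewElt_mul_charElt_of, smul_zero]
  · rw [map_smul, LinearMap.smul_apply, toDual_charElt_mul_skewElt_ι,
      toDual_skewElt_mul_charElt_ι, smul_eq_mul]

/-! ### Products of skew-primitive elements: the effect of the twist -/

section Product
variable {ψ' : G →* ℂ} {ξ' : V →ₗ[ℂ] ℂ} (h' : SemiInvariant (D := D) ψ' ξ')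

/-- The value of `ξ ⊗ ξ'` on a tensor. -/
def tensorEval (ξ ξ' : V →ₗ[ℂ] ℂ) : V ⊗[ℂ] V →ₗ[ℂ] ℂ :=
  LinearMap.mul' ℂ ℂ ∘ₗ TensorProduct.map ξ ξ'

omit [Finite G] [FiniteDimensional ℂ V] in
lemma tensorEval_tmul (v w : V) : tensorEval ξ ξ' (v ⊗ₜ w) = ξ v * ξ' w := by
  simp [tensorEval]

omit [Finite G] [FiniteDimensional ℂ V] in
lemma tensorEval_comm (b : V ⊗[ℂ] V) :
    tensorEval ξ ξ' (TensorProduct.comm ℂ V V b) = tensorEval ξ' ξ b := by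
  induction b with
  | zero => simp
  | add x y hx hy => simp only [map_add, hx, hy]
  | tmul v w => rw [TensorProduct.comm_tmul, tensorEval_tmul, tensorEval_tmul, mul_comm]

omit [Finite G] [FiniteDimensional ℂ V] in
lemma map_triHom_twistMap (b : V ⊗[ℂ] V) :
    Algebra.TensorProduct.map (triHom h) (triHom h') (twistMap D b) =
      tensorEval ξ ξ' b • ((!![0, 1; 0, 0] : Matrix (Fin 2) (Fin 2) ℂ) ⊗ₜ[ℂ]
        (!![0, 1; 0, 0] : Matrix (Fin 2) (Fin 2) ℂ)) := by
  induction b with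
  | zero => simp
  | add x y hx hy => simp only [map_add, hx, hy, add_smul]
  | tmul v w =>
    rw [twistMap_tmul, tensorEval_tmul, Algebra.TensorProduct.map_tmul, map_mul, triHom_ι,
      triHom_ι, triHom_of, smul_mul_assoc, TensorProduct.smul_tmul_smul]
    -- `E₁₂ * diag(ψ(u), 1) = E₁₂`, so the factor `u` in the twist contributes no sign.
    congr 2
    ext i j; fin_cases i <;> fin_cases j <;> simp [Matrix.mul_apply, Fin.sum_univ_two]

omit [Finite G] [FiniteDimensional ℂ V] in
lemma nexp_smul_upper (c : ℂ) :
    nexp (c • ((!![0, 1; 0, 0] : Matrix (Fin 2) (Fin 2) ℂ) ⊗ₜ[ℂ]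
      (!![0, 1; 0, 0] : Matrix (Fin 2) (Fin 2) ℂ))) =
    1 + c • ((!![0, 1; 0, 0] : Matrix (Fin 2) (Fin 2) ℂ) ⊗ₜ[ℂ]
      (!![0, 1; 0, 0] : Matrix (Fin 2) (Fin 2) ℂ)) := by
  have h0 : (!![0, 1; 0, 0] : Matrix (Fin 2) (Fin 2) ℂ) * !![0, 1; 0, 0] = 0 := by
    ext i j; fin_cases i <;> fin_cases j <;> simp [Matrix.mul_apply]
  rw [nexp_eq_sum (k := 2)]
  · simp [Finset.sum_range_succ]
  · rw [pow_two, smul_mul_smul_comm, Algebra.TensorProduct.tmul_mul_tmul, h0]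
    simp

lemma toDual_skewElt_mul_skewElt (a : EGAlgebra D) :
    toDual ℂ _ (skewElt h * skewElt h') a =
      LinearMap.mul' ℂ ℂ (TensorProduct.map upperEntry upperEntry
        ((1 + (-tensorEval ξ ξ' D.B) • ((!![0, 1; 0, 0] : Matrix (Fin 2) (Fin 2) ℂ) ⊗ₜ[ℂ]
          (!![0, 1; 0, 0] : Matrix (Fin 2) (Fin 2) ℂ))) *
        Algebra.TensorProduct.map (triHom h) (triHom h') (comul₀ D a) *
        (1 + tensorEval ξ ξ' D.B • ((!![0, 1; 0, 0] : Matrix (Fin 2) (Fin 2) ℂ) ⊗ₜ[ℂ]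
          (!![0, 1; 0, 0] : Matrix (Fin 2) (Fin 2) ℂ))))) := by
  have key := toDual_mul_comp D (X := triHom h) (Y := triHom h') upperEntry upperEntry a
  refine key.trans ?_
  rw [map_comulHom, map_triHom_twistMap, ← neg_smul, nexp_smul_upper, nexp_smul_upper]

omit [Finite G] [FiniteDimensional ℂ V] in
-- The upper right entries of `E₁₂ P`, `P E₁₂` and `E₁₂ P E₁₂` are `P 1 1`, `P 0 0` and `P 1 0`, so
-- conjugation by the twist brings diagonal entries into view.
lemma upperEntry_conj (a b : ℂ) (P Q : Matrix (Fin 2) (Fin 2) ℂ) :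
    LinearMap.mul' ℂ ℂ (TensorProduct.map upperEntry upperEntry
      ((1 + a • ((!![0, 1; 0, 0] : Matrix (Fin 2) (Fin 2) ℂ) ⊗ₜ[ℂ]
          (!![0, 1; 0, 0] : Matrix (Fin 2) (Fin 2) ℂ))) * (P ⊗ₜ[ℂ] Q) *
        (1 + b • ((!![0, 1; 0, 0] : Matrix (Fin 2) (Fin 2) ℂ) ⊗ₜ[ℂ]
          (!![0, 1; 0, 0] : Matrix (Fin 2) (Fin 2) ℂ))))) =
      P 0 1 * Q 0 1 + a * (P 1 1 * Q 1 1) + b * (P 0 0 * Q 0 0) + a * b * (P 1 0 * Q 1 0) := by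
  simp only [TensorProduct.smul_tmul', Algebra.TensorProduct.one_def, add_mul, mul_add,
    Algebra.TensorProduct.tmul_mul_tmul, map_add, TensorProduct.map_tmul, LinearMap.mul'_apply,
    upperEntry_apply, one_mul, mul_one, Matrix.mul_apply, Fin.sum_univ_two, Matrix.smul_apply]
  simp
  ring

/-- The image of `g` is diagonal, so without the twist the value would be zero; the two surviving
terms are the products of lower and of upper diagonal entries. -/
lemma toDual_skewElt_mul_skewElt_of (g : G) :
    toDual ℂ _ (skewElt h * skewElt h') (of D g) =
      tensorEval ξ ξ' D.B * (ψ g * ψ' g - 1) := by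
  rw [toDual_skewElt_mul_skewElt, comul₀_of, Algebra.TensorProduct.map_tmul, upperEntry_conj]
  simp [triHom_of]
  ring

lemma toDual_skewElt_mul_skewElt_ι (v : V) :
    toDual ℂ _ (skewElt h * skewElt h') (ι D v) = 0 := by
  rw [toDual_skewElt_mul_skewElt, comul₀_ι, map_add, Algebra.TensorProduct.map_tmul,
    Algebra.TensorProduct.map_tmul, mul_add _ (triHom h (ι D v) ⊗ₜ[ℂ] triHom h' 1), add_mul,
    map_add, map_add, upperEntry_conj, upperEntry_conj]
  simp [triHom_of, triHom_ι]

lemma charElt_mul_skewElt_anticomm (hψ : ψ' D.u = -1) :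
    charElt D ψ' * skewElt h = -(skewElt h * charElt D ψ') := by
  rw [charElt_mul_skewElt, hψ, neg_one_smul]

/-- Since `ψ` and `ψ'` are `-1` at `u`, the cross terms in the comultiplication of the
anticommutator cancel. Both sides are then skew-primitive of the same type, vanish on `V`, and agree
on `G`; symmetry of `B` makes the two products contribute equally there. -/
lemma skewElt_anticomm (hψ : ψ D.u = -1) (hψ' : ψ' D.u = -1) :
    skewElt h * skewElt h' + skewElt h' * skewElt h =
      (-2 * tensorEval ξ ξ' D.B) • (1 - charElt D ψ * charElt D ψ') := by
  have hc : charElt D ψ' * charElt D ψ = charElt D ψ * charElt D ψ' := by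
    rw [← map_mul, ← map_mul, mul_comm]
  have hB : tensorEval ξ' ξ D.B = tensorEval ξ ξ' D.B := by
    rw [← tensorEval_comm, D.B_symm]
  refine ext_of_comul_eq (p := 1) (q := charElt D ψ * charElt D ψ') ?_ ?_
    (fun g => ?_) (fun v => ?_)
  · rw [map_add, Bialgebra.comul_mul, Bialgebra.comul_mul, comul_skewElt, comul_skewElt]
    simp only [add_mul, mul_add, Algebra.TensorProduct.tmul_mul_tmul, mul_one, one_mul,
      charElt_mul_skewElt_anticomm h hψ', charElt_mul_skewElt_anticomm h' hψ,
      TensorProduct.add_tmul, TensorProduct.tmul_add, TensorProduct.neg_tmul, hc]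
    abel
  · rw [map_smul, map_sub, Bialgebra.comul_mul, comul_charElt, comul_charElt, Bialgebra.comul_one]
    rw [← TensorProduct.smul_tmul', TensorProduct.tmul_smul, ← smul_add, TensorProduct.sub_tmul,
      TensorProduct.tmul_sub, Algebra.TensorProduct.tmul_mul_tmul, Algebra.TensorProduct.one_def,
      sub_add_sub_cancel]
  · rw [map_add, LinearMap.add_apply, toDual_skewElt_mul_skewElt_of, toDual_skewElt_mul_skewElt_of,
      hB, map_smul, LinearMap.smul_apply, map_sub, LinearMap.sub_apply, HopfDual.toDual_one,
      EGAlgebra.counit_eq, counit₀_of, ← map_mul, toDual_charElt, charHom_of, MonoidHom.mul_apply,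
      smul_eq_mul]
    ring
  · rw [map_add, LinearMap.add_apply, toDual_skewElt_mul_skewElt_ι, toDual_skewElt_mul_skewElt_ι,
      map_smul, LinearMap.smul_apply, map_sub, LinearMap.sub_apply, HopfDual.toDual_one,
      EGAlgebra.counit_eq, counit₀_ι, ← map_mul, toDual_charElt, charHom_ι]
    simp

lemma skewElt_mul_self (hψ : ψ D.u = -1) :
    skewElt h * skewElt h =
      (-tensorEval ξ ξ D.B) • (1 - charElt D ψ * charElt D ψ) := by
  have key := skewElt_anticomm h h hψ hψ
  -- The anticommutator of an element with itself is twice its square, and the factor 2 is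
  -- cancelled.
  rw [← two_smul ℂ, neg_mul_comm, mul_smul] at key
  exact smul_right_injective _ (two_ne_zero (α := ℂ)) key

end Product

end Dual

end EGAlgebra

/-! ### Evaluation of ordered monomials of the dual -/

namespace EGAlgebra
open HopfDual
variable {G V : Type*} [Group G] [AddCommGroup V] [Module ℂ V] {D : TwistDatum G V}
  [Finite G] [FiniteDimensional ℂ V] {ψ ψ' : G →* ℂ} {ξ ξ' : V →ₗ[ℂ] ℂ}
  (h : SemiInvariant (D := D) ψ ξ) (h' : SemiInvariant (D := D) ψ' ξ') (φ : G →* ℂ)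

lemma toDual_charElt_mul_ι (a : EGAlgebra D) (v : V) :
    toDual ℂ _ (charElt D φ) (a * ι D v) = 0 := by
  rw [toDual_charElt, map_mul, charHom_ι, mul_zero]

lemma toDual_skewElt_mul_charElt_mul_ι (a : EGAlgebra D) (v : V) :
    toDual ℂ _ (skewElt h * charElt D φ) (a * ι D v) = charHom D (ψ * φ) a * ξ v := by
  rw [toDual_apply_mul, Bialgebra.comul_mul, comul_skewElt, comul_charElt, add_mul,
    Algebra.TensorProduct.tmul_mul_tmul, Algebra.TensorProduct.tmul_mul_tmul, ← map_mul, one_mul,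
    map_add, LinearMap.add_apply, pairing_tmul, pairing_tmul, toDual_charElt, charHom_ι, mul_zero,
    zero_add, toDual_charElt, toDual_skewElt_mul_charElt_ι]

/-- Splitting off `w`, of the four terms of the comultiplication only the one with `ξ'` evaluated at
`w` survives: the others contain a character at a vector of `V`, or `ξ w = 0`. The twisted value of
the double product is therefore never needed. -/
lemma toDual_skewElt_mul_skewElt_mul_charElt (g : G) (v w : V) (hw : ξ w = 0) :
    toDual ℂ _ (skewElt h * skewElt h' * charElt D φ) (of D g * ι D v * ι D w) =
      (ψ g * ψ' g * φ g) * (ξ v * ξ' w) := by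
  rw [toDual_apply_mul, Bialgebra.comul_mul, Bialgebra.comul_mul, comul_skewElt, comul_skewElt,
    comul_charElt]
  simp only [add_mul, mul_add, Algebra.TensorProduct.tmul_mul_tmul, one_mul, mul_one, map_add,
    LinearMap.add_apply, pairing_tmul, toDual_skewElt_mul_charElt_ι, hw, mul_zero, add_zero]
  rw [mul_assoc (skewElt h) (charElt D ψ'), ← map_mul, ← map_mul, ← map_mul,
    toDual_charElt_mul_ι, toDual_charElt, charHom_ι, toDual_skewElt_mul_charElt_mul_ι, charHom_of]
  simp only [MonoidHom.mul_apply]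
  ring

end EGAlgebra

/-! ### The isomorphism for an abstract dual pair -/

section Duality
open HopfDual EGAlgebra
variable {Γ G : Type*} [CommGroup Γ] [CommGroup G] {L : LiftingDatum Γ}
  {D : TwistDatum G (Fin 2 → ℂ)} {χ : Fin 2 → (G →* ℂ)} {θ : Γ →* (G →* ℂ)}

/-- The conditions under which the lifting `L` over `Γ` is dual to the Hopf algebra given by the
twist datum `D` over `G`: `θ` identifies `Γ` with the character group of `G`. -/
structure IsDualPair (L : LiftingDatum Γ) (D : TwistDatum G (Fin 2 → ℂ))
    (χ : Fin 2 → (G →* ℂ)) (θ : Γ →* (G →* ℂ)) : Prop where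
  rho : D.ρ = diagRep χ
  tensor : D.B = tensorOfMatrix (lamMatrix L.lam₁ L.lam₂ L.lam₃)
  injective : Function.Injective θ
  map_g : ∀ i, θ (L.g i) = χ i
  map_u : ∀ γ, θ γ D.u = L.χ γ
  card : Nat.card Γ = Nat.card G

/-- The coordinate forms of `ℂ²`, scaled by a square root of `-1`. -/
def coordForm (i : Fin 2) : (Fin 2 → ℂ) →ₗ[ℂ] ℂ := Complex.I • LinearMap.proj i

lemma coordForm_apply (i : Fin 2) (v : Fin 2 → ℂ) : coordForm i v = Complex.I * v i := rfl

/-- The factor `I * I = -1` offsets the minus sign in the relations between skew-primitive elements,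
so that `M` itself appears in the presentation. -/
lemma tensorEval_coordForm (M : Matrix (Fin 2) (Fin 2) ℂ) (i j : Fin 2) :
    tensorEval (coordForm i) (coordForm j) (tensorOfMatrix M) = -M i j := by
  simp only [tensorOfMatrix, Fin.sum_univ_two, map_add, map_smul, tensorEval_tmul, coordForm_apply,
    smul_eq_mul]
  have hI := Complex.I_mul_I
  fin_cases i <;> fin_cases j <;> simp

omit [CommGroup G] in
lemma monoidHom_ne_zero [Group G] (ψ : G →* ℂ) (g : G) : ψ g ≠ 0 :=
  ((Group.isUnit g).map ψ).ne_zero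

namespace IsDualPair
variable (P : IsDualPair L D χ θ)
include P

lemma semiInvariant (i : Fin 2) : SemiInvariant (D := D) (χ i) (coordForm i) where
  map_rho g v := by
    rw [P.rho, coordForm_apply, coordForm_apply, diagRep_apply]; ring

lemma char_u (i : Fin 2) : χ i D.u = -1 := by
  rw [← P.map_g, P.map_u, L.χ_g]

variable [Finite G]

lemma skewElt_anticomm (i j : Fin 2) :
    skewElt (P.semiInvariant i) * skewElt (P.semiInvariant j) +
      skewElt (P.semiInvariant j) * skewElt (P.semiInvariant i) =
      (2 * lamMatrix L.lam₁ L.lam₂ L.lam₃ i j) •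
        (1 - charElt D (χ i) * charElt D (χ j)) := by
  rw [EGAlgebra.skewElt_anticomm _ _ (P.char_u i) (P.char_u j), P.tensor, tensorEval_coordForm,
    neg_mul_neg]

lemma skewElt_mul_self (i : Fin 2) :
    skewElt (P.semiInvariant i) * skewElt (P.semiInvariant i) =
      lamMatrix L.lam₁ L.lam₂ L.lam₃ i i • (1 - charElt D (χ i) * charElt D (χ i)) := by
  rw [EGAlgebra.skewElt_mul_self _ (P.char_u i), P.tensor, tensorEval_coordForm, neg_neg]

/-- The algebra map from the lifting to the dual. -/
def algHom : Lifting L →ₐ[ℂ] HopfDual ℂ (EGAlgebra D) :=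
  Lifting.lift ((charElt D).comp θ) (fun i => skewElt (P.semiInvariant i))
    (fun γ i => by
      rw [MonoidHom.comp_apply, charElt_mul_skewElt, P.map_u])
    (by rw [P.skewElt_mul_self, MonoidHom.comp_apply, P.map_g]; rfl)
    (by rw [P.skewElt_mul_self, MonoidHom.comp_apply, P.map_g]; rfl)
    (by
      rw [P.skewElt_anticomm, MonoidHom.comp_apply, MonoidHom.comp_apply, P.map_g, P.map_g]
      congr 1
      -- The off-diagonal entry is half of `λ₃`, and the anticommutator doubles it.
      exact mul_div_cancel₀ _ two_ne_zero)

lemma algHom_of (γ : Γ) : P.algHom (Lifting.of L γ) = charElt D (θ γ) :=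
  Lifting.lift_of _ _ _ _ _ _ _

lemma algHom_x (i : Fin 2) : P.algHom (Lifting.x L i) = skewElt (P.semiInvariant i) :=
  Lifting.lift_x _ _ _ _ _ _ _

/-- The bialgebra map from the lifting to the dual. -/
def bialgHom : Lifting L →ₐc[ℂ] HopfDual ℂ (EGAlgebra D) :=
  BialgHom.ofAlgHom P.algHom
    (by
      refine Lifting.algHom_ext (fun γ => ?_) (fun i => ?_)
      · rw [AlgHom.comp_apply, algHom_of, Bialgebra.counitAlgHom_apply,
          Bialgebra.counitAlgHom_apply, Lifting.counit_eq, Lifting.counitHom_of, HopfDual.counit_eq,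
          toDual_charElt, map_one]
      · rw [AlgHom.comp_apply, algHom_x, Bialgebra.counitAlgHom_apply,
          Bialgebra.counitAlgHom_apply, Lifting.counit_eq, Lifting.counitHom_x, HopfDual.counit_eq,
          ← map_one (of D), toDual_skewElt_of])
    (by
      refine Lifting.algHom_ext (fun γ => ?_) (fun i => ?_)
      · rw [AlgHom.comp_apply, AlgHom.comp_apply, algHom_of, Bialgebra.comulAlgHom_apply,
          Bialgebra.comulAlgHom_apply, Lifting.comul_eq, Lifting.comulHom_of, comul_charElt,
          Algebra.TensorProduct.map_tmul, algHom_of]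
      · rw [AlgHom.comp_apply, AlgHom.comp_apply, algHom_x, Bialgebra.comulAlgHom_apply,
          Bialgebra.comulAlgHom_apply, Lifting.comul_eq, Lifting.comulHom_x, comul_skewElt, map_add,
          Algebra.TensorProduct.map_tmul, Algebra.TensorProduct.map_tmul, algHom_of, algHom_x,
          map_one, P.map_g])

variable [Fintype Γ]

omit [Finite G] in
-- Dedekind independence of characters, with a nowhere vanishing weight `s` to be cancelled
-- pointwise.
lemma eq_zero_of_sum_char {c : Γ → ℂ} {s : G → ℂ} (hs : ∀ g, s g ≠ 0)
    (hc : ∀ g, ∑ γ, c γ * (s g * θ γ g) = 0) (γ : Γ) : c γ = 0 := by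
  have hli := (linearIndependent_monoidHom G ℂ).comp θ P.injective
  refine Fintype.linearIndependent_iff.mp hli c ?_ γ
  ext g
  have h1 : s g * ∑ γ, c γ * θ γ g = 0 := by
    rw [← hc g, Finset.mul_sum]
    exact Finset.sum_congr rfl fun γ _ => by ring
  simpa using (mul_eq_zero.mp h1).resolve_left (hs g)

/-- The evaluations are triangular with respect to the degree in the skew-primitive elements, so
coefficients are eliminated from the top degree down. Each stage leaves a weighted relation between
distinct characters of `G`. -/
lemma linearIndependent_dual :
    LinearIndependent ℂ (normalMonomial ((charElt D).comp θ)
      (fun i => skewElt (P.semiInvariant i))) := by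
  rw [Fintype.linearIndependent_iff]
  intro c hc
  have heval (a : EGAlgebra D) : ∑ γ,
      (c (γ, 0) * toDual ℂ _ (charElt D (θ γ)) a +
        c (γ, 1) * toDual ℂ _ (skewElt (P.semiInvariant 0) * charElt D (θ γ)) a +
        c (γ, 2) * toDual ℂ _ (skewElt (P.semiInvariant 1) * charElt D (θ γ)) a +
        c (γ, 3) * toDual ℂ _ (skewElt (P.semiInvariant 0) * skewElt (P.semiInvariant 1) *
          charElt D (θ γ)) a) = 0 := by
    have h1 := congrArg (fun f => toDual ℂ _ f a) hc
    simpa [Fintype.sum_prod_type, Fin.sum_univ_four, normalMonomial] using h1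
  have hI := Complex.I_ne_zero
  have c3 : ∀ γ, c (γ, 3) = 0 := by
    refine P.eq_zero_of_sum_char (s := fun g => χ 0 g * χ 1 g * (Complex.I * Complex.I))
      (fun g => mul_ne_zero (mul_ne_zero (monoidHom_ne_zero _ _) (monoidHom_ne_zero _ _))
        (mul_ne_zero hI hI)) (fun g => ?_)
    -- Two trailing vectors annihilate every monomial with fewer than two skew-primitive factors.
    rw [← heval (of D g * e D 0 * e D 1)]
    refine Finset.sum_congr rfl fun γ _ => ?_
    rw [e, e, toDual_charElt_mul_ι, toDual_skewElt_mul_charElt_mul_ι,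
      toDual_skewElt_mul_charElt_mul_ι, map_mul, charHom_ι, map_mul, charHom_ι,
      toDual_skewElt_mul_skewElt_mul_charElt _ _ _ _ _ _ (by simp [coordForm_apply])]
    simp [coordForm_apply]
  simp only [c3, zero_mul, add_zero] at heval
  have c2 : ∀ γ, c (γ, 2) = 0 := by
    refine P.eq_zero_of_sum_char (s := fun g => χ 1 g * Complex.I)
      -- On `g * e 1` the other linear monomial also vanishes, because the zeroth coordinate of the
      -- basis vector is zero.
      (fun g => mul_ne_zero (monoidHom_ne_zero _ _) hI) (fun g => ?_)
    rw [← heval (of D g * e D 1)]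
    refine Finset.sum_congr rfl fun γ _ => ?_
    rw [e, toDual_charElt_mul_ι, toDual_skewElt_mul_charElt_mul_ι,
      toDual_skewElt_mul_charElt_mul_ι, charHom_of, charHom_of]
    simp [coordForm_apply]
    left; ring
  have c1 : ∀ γ, c (γ, 1) = 0 := by
    refine P.eq_zero_of_sum_char (s := fun g => χ 0 g * Complex.I)
      (fun g => mul_ne_zero (monoidHom_ne_zero _ _) hI) (fun g => ?_)
    rw [← heval (of D g * e D 0)]
    refine Finset.sum_congr rfl fun γ _ => ?_
    rw [e, toDual_charElt_mul_ι, toDual_skewElt_mul_charElt_mul_ι,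
      toDual_skewElt_mul_charElt_mul_ι, charHom_of, charHom_of]
    simp [coordForm_apply]
    left; ring
  have c0 : ∀ γ, c (γ, 0) = 0 := by
    refine P.eq_zero_of_sum_char (s := fun _ => 1) (fun g => one_ne_zero) (fun g => ?_)
    rw [← heval (of D g)]
    refine Finset.sum_congr rfl fun γ _ => ?_
    rw [c1, c2, toDual_charElt, charHom_of]
    ring
  rintro ⟨γ, m⟩
  fin_cases m
  exacts [c0 γ, c1 γ, c2 γ, c3 γ]

omit [Fintype Γ] in
lemma algHom_normalMonomial (p : Γ × Fin 4) :
    P.algHom (normalMonomial (Lifting.of L) (Lifting.x L) p) =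
      normalMonomial ((charElt D).comp θ) (fun i => skewElt (P.semiInvariant i)) p := by
  rw [map_normalMonomial]
  congr 1
  · ext γ; exact P.algHom_of γ
  · ext i : 1; exact P.algHom_x i

/-- The basis of normal monomials of the lifting. -/
def basis : Module.Basis (Γ × Fin 4) ℂ (Lifting L) :=
  .mk (v := normalMonomial (Lifting.of L) (Lifting.x L))
    -- Independence in the abstractly presented algebra is pulled back from the dual, where elements
    -- are actual functions.
    (LinearIndependent.of_comp P.algHom.toLinearMap (by
      convert P.linearIndependent_dual using 1
      ext1 p
      exact P.algHom_normalMonomial p))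
    (Lifting.span_normalMonomial L).ge

lemma basis_apply (p : Γ × Fin 4) :
    P.basis p = normalMonomial (Lifting.of L) (Lifting.x L) p := Module.Basis.mk_apply _ _ _

lemma finrank_lifting : Module.finrank ℂ (Lifting L) = Fintype.card Γ * 4 := by
  rw [Module.finrank_eq_card_basis P.basis, Fintype.card_prod, Fintype.card_fin]

/-- A basis goes to an independent family, and the target has dimension at most `4 |G| = 4 |Γ|`, the
dimension of the source. -/
lemma bialgHom_bijective : Function.Bijective P.bialgHom := by
  have := Fintype.ofFinite G
  have hfin : Module.Finite ℂ (Lifting L) := .of_basis P.basis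
  have hfin' : Module.Finite ℂ (HopfDual ℂ (EGAlgebra D)) :=
    .equiv (toDual ℂ (EGAlgebra D)).symm
  have hinj : Function.Injective P.algHom.toLinearMap := by
    have hcomp : P.algHom.toLinearMap = Finsupp.linearCombination ℂ
        (fun p => P.algHom (P.basis p)) ∘ₗ P.basis.repr.toLinearMap :=
      P.basis.ext fun p => by simp
    have hli : LinearIndependent ℂ (fun p => P.algHom (P.basis p)) := by
      convert P.linearIndependent_dual using 1
      ext1 p
      rw [basis_apply, algHom_normalMonomial]
    rw [hcomp, LinearMap.coe_comp]
    exact Function.Injective.comp hli P.basis.repr.injective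
  have hle : Module.finrank ℂ (HopfDual ℂ (EGAlgebra D)) ≤ Module.finrank ℂ (Lifting L) := by
    rw [(toDual ℂ (EGAlgebra D)).finrank_eq, Subspace.dual_finrank_eq, P.finrank_lifting,
      ← Nat.card_eq_fintype_card, P.card, Nat.card_eq_fintype_card]
    simpa using finrank_le D P.rho
  have heq : Module.finrank ℂ (Lifting L) = Module.finrank ℂ (HopfDual ℂ (EGAlgebra D)) :=
    le_antisymm (LinearMap.finrank_le_finrank_of_injective hinj) hle
  exact ⟨hinj, (LinearMap.injective_iff_surjective_of_finrank_eq_finrank heq).mp hinj⟩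

/-- The isomorphism of the lifting with the dual. -/
def equiv : Lifting L ≃ₐc[ℂ] HopfDual ℂ (EGAlgebra D) :=
  BialgEquiv.ofBijective P.bialgHom P.bialgHom_bijective

end IsDualPair
end Duality

/-! ### Subcoalgebras and pointedness -/

section Subcoalgebra
variable {C : Type*} [AddCommGroup C] [Module ℂ C] [Coalgebra ℂ C]

/-- `c ↦ ∑ f(c₍₂₎) c₍₁₎`. -/
def rightSlice (f : C →ₗ[ℂ] ℂ) : C →ₗ[ℂ] C :=
  (TensorProduct.rid ℂ C).toLinearMap ∘ₗ f.lTensor C ∘ₗ Coalgebra.comul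

/-- Contracting the right leg of a tensor in `E ⊗ E` leaves a combination of its left legs, which
lie in `E`. -/
lemma IsSubcoalgebra.rightSlice_mem {E : Submodule ℂ C} (hE : IsSubcoalgebra E)
    (f : C →ₗ[ℂ] ℂ) {c : C} (hc : c ∈ E) : rightSlice f c ∈ E := by
  obtain ⟨t, ht⟩ := hE c hc
  rw [rightSlice, LinearMap.comp_apply, LinearMap.comp_apply, ← ht]
  clear ht
  induction t with
  | zero => simp
  | add s t hs ht => simp only [map_add]; exact E.add_mem hs ht
  | tmul a b => simpa using E.smul_mem _ a.2

lemma isSubcoalgebra_span_singleton {c : C} (hc : IsGroupLikeElem ℂ c) :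
    IsSubcoalgebra (Submodule.span ℂ {c}) := by
  intro a ha
  obtain ⟨r, rfl⟩ := Submodule.mem_span_singleton.mp ha
  have hm := Submodule.mem_span_singleton_self (R := ℂ) c
  refine ⟨r • ((⟨c, hm⟩ : Submodule.span ℂ {c}) ⊗ₜ ⟨c, hm⟩), ?_⟩
  rw [map_smul, map_smul, hc.comul_eq_tmul_self, TensorProduct.map_tmul]
  rfl

end Subcoalgebra

/-- If every nonzero subcoalgebra contains a group-like element, the coalgebra is pointed. -/
lemma isPointed_of_exists_groupLike {C : Type*} [AddCommGroup C] [Module ℂ C] [Coalgebra ℂ C]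
    (h : ∀ E : Submodule ℂ C, IsSubcoalgebra E → E ≠ ⊥ → ∃ c ∈ E, IsGroupLikeElem ℂ c) :
    IsPointed ℂ C := by
  rintro E ⟨hE, hne, hmin⟩
  obtain ⟨c, hc, hg⟩ := h E hE hne
  rcases hmin _ (isSubcoalgebra_span_singleton hg)
    ((Submodule.span_singleton_le_iff_mem _ _).mpr hc) with h0 | h1
  · exact absurd (Submodule.span_singleton_eq_bot.mp h0) hg.ne_zero
  · rw [← h1, finrank_span_singleton hg.ne_zero]

namespace Lifting
variable {Γ : Type*} [CommGroup Γ] (L : LiftingDatum Γ)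

lemma isGroupLikeElem_of (γ : Γ) : IsGroupLikeElem ℂ (of L γ) :=
  ⟨counitHom_of L γ, comulHom_of L γ⟩

end Lifting

/-! ### Coradical and group-like elements of the lifting -/

namespace IsDualPair
open HopfDual EGAlgebra
variable {Γ G : Type*} [CommGroup Γ] [CommGroup G] {L : LiftingDatum Γ}
  {D : TwistDatum G (Fin 2 → ℂ)} {χ : Fin 2 → (G →* ℂ)} {θ : Γ →* (G →* ℂ)}
  (P : IsDualPair L D χ θ) [Finite G] [Fintype Γ]
include P

lemma basis_zero (γ : Γ) : P.basis (γ, 0) = Lifting.of L γ := by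
  simp [basis_apply, normalMonomial]

lemma basis_one (γ : Γ) : P.basis (γ, 1) = Lifting.x L 0 * Lifting.of L γ := by
  simp [basis_apply, normalMonomial]

lemma basis_two (γ : Γ) : P.basis (γ, 2) = Lifting.x L 1 * Lifting.of L γ := by
  simp [basis_apply, normalMonomial]

lemma basis_three (γ : Γ) :
    P.basis (γ, 3) = Lifting.x L 0 * Lifting.x L 1 * Lifting.of L γ := by
  simp [basis_apply, normalMonomial]

/-- In this and the next three formulas only the right legs are written in the basis, since slicing
applies coordinate functionals there. The basis vector itself recurs as a right leg against a group
element, and all other right legs have a smaller second index. -/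
lemma comul_basis_zero (γ : Γ) :
    Coalgebra.comul (R := ℂ) (P.basis (γ, 0)) = Lifting.of L γ ⊗ₜ P.basis (γ, 0) := by
  rw [basis_zero, Lifting.comul_eq, Lifting.comulHom_of]

lemma comul_basis_one (γ : Γ) :
    Coalgebra.comul (R := ℂ) (P.basis (γ, 1)) =
      P.basis (γ, 1) ⊗ₜ P.basis (γ, 0) + Lifting.of L (L.g 0 * γ) ⊗ₜ P.basis (γ, 1) := by
  rw [basis_zero, basis_one, Lifting.comul_eq, map_mul, Lifting.comulHom_of, Lifting.comulHom_x]
  simp [add_mul, Algebra.TensorProduct.tmul_mul_tmul]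

lemma comul_basis_two (γ : Γ) :
    Coalgebra.comul (R := ℂ) (P.basis (γ, 2)) =
      P.basis (γ, 2) ⊗ₜ P.basis (γ, 0) + Lifting.of L (L.g 1 * γ) ⊗ₜ P.basis (γ, 2) := by
  rw [basis_zero, basis_two, Lifting.comul_eq, map_mul, Lifting.comulHom_of, Lifting.comulHom_x]
  simp [add_mul, Algebra.TensorProduct.tmul_mul_tmul]

lemma comul_basis_three (γ : Γ) :
    Coalgebra.comul (R := ℂ) (P.basis (γ, 3)) =
      P.basis (γ, 3) ⊗ₜ P.basis (γ, 0) +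
        (Lifting.of L (L.g 0) * Lifting.x L 1 * Lifting.of L γ) ⊗ₜ P.basis (γ, 1) +
        ((Lifting.x L 0 * Lifting.of L (L.g 1) * Lifting.of L γ) ⊗ₜ P.basis (γ, 2) +
        Lifting.of L (L.g 0 * L.g 1 * γ) ⊗ₜ P.basis (γ, 3)) := by
  rw [basis_zero, basis_one, basis_two, basis_three, Lifting.comul_eq, map_mul, map_mul,
    Lifting.comulHom_of, Lifting.comulHom_x, Lifting.comulHom_x]
  simp [add_mul, mul_add, Algebra.TensorProduct.tmul_mul_tmul]

/-- If `p` is a leading index of `d`, no other term of `d` contributes to the slice at `p`; what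
remains is a nonzero multiple of a group element. -/
lemma rightSlice_mem {E : Submodule ℂ (Lifting L)} (hE : IsSubcoalgebra E) {d : Lifting L}
    (hd : d ∈ E) (p : Γ × Fin 4) {γ : Γ} (hdp : P.basis.repr d p ≠ 0)
    (hp : rightSlice (P.basis.coord p) (P.basis p) = Lifting.of L γ)
    (hq : ∀ q ≠ p, P.basis.repr d q = 0 ∨ rightSlice (P.basis.coord p) (P.basis q) = 0) :
    Lifting.of L γ ∈ E := by
  have h1 : rightSlice (P.basis.coord p) d = P.basis.repr d p • Lifting.of L γ := by
    conv_lhs => rw [← P.basis.sum_repr d]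
    rw [map_sum, Finset.sum_eq_single p]
    · rw [map_smul, hp]
    · intro q _ hqp
      rw [map_smul]
      rcases hq q hqp with h | h <;> simp [h]
    · simp
  have h2 := hE.rightSlice_mem (P.basis.coord p) hd
  rw [h1] at h2
  simpa [smul_smul, hdp] using E.smul_mem (P.basis.repr d p)⁻¹ h2

/-- The leading index of a nonzero `d` is found by trying the second index 3, 2, 1, 0 in turn. Terms
of higher index have zero coefficient by then, and the remaining ones do not have the chosen basis
vector as a right leg. -/
lemma exists_of_mem {E : Submodule ℂ (Lifting L)} (hE : IsSubcoalgebra E) (hne : E ≠ ⊥) :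
    ∃ γ, Lifting.of L γ ∈ E := by
  classical
  obtain ⟨d, hd, hd0⟩ := E.exists_mem_ne_zero_of_ne_bot hne
  by_cases h3 : ∃ γ, P.basis.repr d (γ, 3) ≠ 0
  · obtain ⟨γ, hγ⟩ := h3
    refine ⟨_, P.rightSlice_mem hE hd (γ, 3) (γ := L.g 0 * L.g 1 * γ) hγ ?_ fun q hq => .inr ?_⟩
    · simp [rightSlice, comul_basis_three]
    · obtain ⟨δ, m⟩ := q
      fin_cases m <;>
        simp_all [rightSlice, comul_basis_zero, comul_basis_one, comul_basis_two, comul_basis_three]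
  push Not at h3
  by_cases h2 : ∃ γ, P.basis.repr d (γ, 2) ≠ 0
  · obtain ⟨γ, hγ⟩ := h2
    refine ⟨_, P.rightSlice_mem hE hd (γ, 2) (γ := L.g 1 * γ) hγ ?_ fun q hq => ?_⟩
    · simp [rightSlice, comul_basis_two]
    · obtain ⟨δ, m⟩ := q
      fin_cases m <;>
        simp_all [rightSlice, comul_basis_zero, comul_basis_one, comul_basis_two]
  push Not at h2
  by_cases h1 : ∃ γ, P.basis.repr d (γ, 1) ≠ 0
  · obtain ⟨γ, hγ⟩ := h1
    refine ⟨_, P.rightSlice_mem hE hd (γ, 1) (γ := L.g 0 * γ) hγ ?_ fun q hq => ?_⟩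
    · simp [rightSlice, comul_basis_one]
    · obtain ⟨δ, m⟩ := q
      fin_cases m <;>
        simp_all [rightSlice, comul_basis_zero, comul_basis_one]
  push Not at h1
  by_cases h0 : ∃ γ, P.basis.repr d (γ, 0) ≠ 0
  · obtain ⟨γ, hγ⟩ := h0
    refine ⟨_, P.rightSlice_mem hE hd (γ, 0) (γ := γ) hγ ?_ fun q hq => ?_⟩
    · simp [rightSlice, comul_basis_zero]
    · obtain ⟨δ, m⟩ := q
      fin_cases m <;> simp_all [rightSlice, comul_basis_zero]
  push Not at h0
  refine absurd (P.basis.repr.map_eq_zero_iff.mp ?_) hd0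
  ext ⟨γ, m⟩
  fin_cases m
  exacts [h0 γ, h1 γ, h2 γ, h3 γ]

lemma isPointed : IsPointed ℂ (Lifting L) :=
  isPointed_of_exists_groupLike fun _ hE hne =>
    (P.exists_of_mem hE hne).elim fun γ hγ => ⟨_, hγ, Lifting.isGroupLikeElem_of L γ⟩

/-- The group-like elements of the lifting are the elements of `Γ`. -/
def groupLikeEquiv : GroupLike ℂ (Lifting L) ≃* Γ :=
  MulEquiv.symm <| MulEquiv.ofBijective
    ({ toFun := fun γ => ⟨Lifting.of L γ, Lifting.isGroupLikeElem_of L γ⟩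
       map_one' := GroupLike.val_injective (map_one (Lifting.of L))
       map_mul' := fun γ δ => GroupLike.val_injective (map_mul (Lifting.of L) γ δ) } :
      Γ →* GroupLike ℂ (Lifting L)) <| by
    constructor
    · intro γ δ h
      have h1 : Lifting.of L γ = Lifting.of L δ := congrArg GroupLike.val h
      rw [← P.basis_zero, ← P.basis_zero] at h1
      exact congrArg Prod.fst (P.basis.injective h1)
    · rintro ⟨a, ha⟩
      -- The line through a group-like element is a nonzero subcoalgebra, so it contains some
      -- element of `Γ`; the counit then forces the proportionality factor to be 1.
      obtain ⟨γ, hγ⟩ := P.exists_of_mem (isSubcoalgebra_span_singleton ha)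
        (Submodule.span_singleton_eq_bot.not.mpr ha.ne_zero)
      obtain ⟨r, hr⟩ := Submodule.mem_span_singleton.mp hγ
      have h1 := congrArg (Coalgebra.counit (R := ℂ)) hr
      rw [map_smul, ha.counit_eq_one, (Lifting.isGroupLikeElem_of L γ).counit_eq_one,
        smul_eq_mul, mul_one] at h1
      refine ⟨γ, GroupLike.val_injective ?_⟩
      change Lifting.of L γ = a
      rw [← hr, h1, one_smul]

end IsDualPair

/-! ### The three families: self-duality of the groups -/

section Families

/-- The self-duality of `ℤ/N`, sending `m` to the character `a ↦ e^{2πima/N}`. -/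
def zmodDual (N : ℕ) [NeZero N] :
    Multiplicative (ZMod N) →* (Multiplicative (ZMod N) →* ℂ) where
  toFun m := (AddChar.mulShift (ZMod.stdAddChar (N := N)) m.toAdd).toMonoidHom
  map_one' := by ext a; simp
  map_mul' m n := by
    rw [toAdd_mul, ← AddChar.mulShift_mul]; rfl

lemma zmodDual_apply (N : ℕ) [NeZero N] (m a : Multiplicative (ZMod N)) :
    zmodDual N m a = stdChar N (Multiplicative.ofAdd (m.toAdd * a.toAdd)) := rfl

lemma zmodDual_injective (N : ℕ) [NeZero N] : Function.Injective (zmodDual N) := by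
  intro m n h
  refine AddChar.to_mulShift_inj_of_isPrimitive (ZMod.isPrimitive_stdAddChar N)
    (DFunLike.ext _ _ fun a => ?_)
  exact DFunLike.congr_fun h (Multiplicative.ofAdd a)

lemma zmodDual_natCast (N : ℕ) [NeZero N] (k : ℕ) :
    zmodDual N (Multiplicative.ofAdd (k : ZMod N)) = stdChar N ^ k := by
  refine MonoidHom.ext fun a => ?_
  rw [zmodDual_apply, MonoidHom.pow_apply, ← map_pow, toAdd_ofAdd, ← nsmul_eq_mul]
  rfl

lemma zmodDual_one (N : ℕ) [NeZero N] :
    zmodDual N (Multiplicative.ofAdd 1) = stdChar N := by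
  simpa using zmodDual_natCast N 1

lemma zmodDual_comm (N : ℕ) [NeZero N] (m a : Multiplicative (ZMod N)) :
    zmodDual N m a = zmodDual N a m := by
  rw [zmodDual_apply, zmodDual_apply, mul_comm]

/-- Oddness of `k` is what makes both characters equal `-1` at `u`, so one argument treats both
exponents. -/
lemma isDualPair_Z8 (k : ℕ) (hk : Odd k) (lam₁ lam₂ lam₃ : ℂ) :
    IsDualPair (liftingZ8 k hk lam₁ lam₂ lam₃)
      (twistZ8 k hk (lamMatrix lam₁ lam₂ lam₃) (lamMatrix_isSymm lam₁ lam₂ lam₃))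
      ![stdChar 8, stdChar 8 ^ k] (zmodDual 8) where
  rho := rfl
  tensor := rfl
  injective := zmodDual_injective 8
  map_g i := by
    fin_cases i
    exacts [zmodDual_one 8, zmodDual_natCast 8 k]
  map_u γ := by
    -- By symmetry of the pairing, evaluating the character of `γ` at `u = a⁴` is evaluating the
    -- fourth power of the standard character at `γ`.
    rw [zmodDual_comm]
    exact DFunLike.congr_fun (zmodDual_natCast 8 4) γ
  card := rfl

/-- The self-duality of `ℤ/M × ℤ/N`. -/
def zmodProdDual (M N : ℕ) [NeZero M] [NeZero N] :
    Multiplicative (ZMod M) × Multiplicative (ZMod N) →*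
      (Multiplicative (ZMod M) × Multiplicative (ZMod N) →* ℂ) where
  toFun p := (zmodDual M p.1).comp (MonoidHom.fst _ _) * (zmodDual N p.2).comp (MonoidHom.snd _ _)
  map_one' := by ext; simp
  map_mul' p q := by
    ext a
    simp only [Prod.fst_mul, Prod.snd_mul, map_mul, MonoidHom.mul_apply, MonoidHom.comp_apply]
    ring

lemma zmodProdDual_apply (M N : ℕ) [NeZero M] [NeZero N]
    (p a : Multiplicative (ZMod M) × Multiplicative (ZMod N)) :
    zmodProdDual M N p a = zmodDual M p.1 a.1 * zmodDual N p.2 a.2 := rfl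

lemma zmodProdDual_injective (M N : ℕ) [NeZero M] [NeZero N] :
    Function.Injective (zmodProdDual M N) := by
  intro p q h
  refine Prod.ext (zmodDual_injective M ?_) (zmodDual_injective N ?_)
  · refine MonoidHom.ext fun a => ?_
    simpa [zmodProdDual_apply] using DFunLike.congr_fun h (a, 1)
  · refine MonoidHom.ext fun a => ?_
    simpa [zmodProdDual_apply] using DFunLike.congr_fun h (1, a)

lemma isDualPair_Z4Z2 (lam₁ lam₂ lam₃ : ℂ) :
    IsDualPair (liftingZ4Z2 lam₁ lam₂ lam₃)
      (twistZ4Z2 (lamMatrix lam₁ lam₂ lam₃) (lamMatrix_isSymm lam₁ lam₂ lam₃))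
      ![(stdChar 4).comp (MonoidHom.fst _ _),
        (stdChar 4).comp (MonoidHom.fst _ _) * (stdChar 2).comp (MonoidHom.snd _ _)]
      (zmodProdDual 4 2) where
  rho := rfl
  tensor := rfl
  injective := zmodProdDual_injective 4 2
  map_g i := by
    ext a
    rw [zmodProdDual_apply]
    fin_cases i
    · change zmodDual 4 (Multiplicative.ofAdd 1) a.1 * zmodDual 2 1 a.2 = stdChar 4 a.1
      rw [zmodDual_one, map_one, MonoidHom.one_apply, mul_one]
    · change zmodDual 4 (Multiplicative.ofAdd 1) a.1 * zmodDual 2 (Multiplicative.ofAdd 1) a.2 =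
        stdChar 4 a.1 * stdChar 2 a.2
      rw [zmodDual_one, zmodDual_one]
  map_u γ := by
    change zmodDual 4 γ.1 (Multiplicative.ofAdd 2) * zmodDual 2 γ.2 1 = _
    -- The same symmetry with `u = a²`; the second factor plays no role because `u` has trivial
    -- component there.
    rw [map_one, mul_one, zmodDual_comm]
    exact DFunLike.congr_fun (zmodDual_natCast 4 2) γ.1
  card := rfl

end Families
end EtingofGelaki
end

open EtingofGelaki in
theorem theorem4p1 (lam₁ lam₂ lam₃ : ℂ) :
    (Module.finrank ℂ (Lifting (liftingZ4Z2 lam₁ lam₂ lam₃)) = 32 ∧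
      IsPointed ℂ (Lifting (liftingZ4Z2 lam₁ lam₂ lam₃)) ∧
      Nonempty (GroupLike ℂ (Lifting (liftingZ4Z2 lam₁ lam₂ lam₃)) ≃*
        Multiplicative (ZMod 4) × Multiplicative (ZMod 2)) ∧
      Nonempty (Lifting (liftingZ4Z2 lam₁ lam₂ lam₃) ≃ₐc[ℂ]
        HopfDual ℂ (EGAlgebra
          (twistZ4Z2 (lamMatrix lam₁ lam₂ lam₃) (lamMatrix_isSymm lam₁ lam₂ lam₃))))) ∧
    (∀ k : ℕ, ∀ hk : Odd k, k = 3 ∨ k = 5 →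
      Module.finrank ℂ (Lifting (liftingZ8 k hk lam₁ lam₂ lam₃)) = 32 ∧
      IsPointed ℂ (Lifting (liftingZ8 k hk lam₁ lam₂ lam₃)) ∧
      Nonempty (GroupLike ℂ (Lifting (liftingZ8 k hk lam₁ lam₂ lam₃)) ≃*
        Multiplicative (ZMod 8)) ∧
      Nonempty (Lifting (liftingZ8 k hk lam₁ lam₂ lam₃) ≃ₐc[ℂ]
        HopfDual ℂ (EGAlgebra
          (twistZ8 k hk (lamMatrix lam₁ lam₂ lam₃) (lamMatrix_isSymm lam₁ lam₂ lam₃))))) := by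
  constructor
  · have P := isDualPair_Z4Z2 lam₁ lam₂ lam₃
    exact ⟨P.finrank_lifting, P.isPointed, ⟨P.groupLikeEquiv⟩, ⟨P.equiv⟩⟩
  · intro k hk _
    have P := isDualPair_Z8 k hk lam₁ lam₂ lam₃
    exact ⟨P.finrank_lifting, P.isPointed, ⟨P.groupLikeEquiv⟩, ⟨P.equiv⟩⟩
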